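/- Let $\psi=\Gamma'/\Gamma$ and, for $x>0$, let $F(x)=\sum_{m\ge1}\frac{\psi(mx)-\log(mx)}{m}$ be the Herglotz function and $$\mathcal F(x)=F(x)-F(1)+\frac{\pi^2}{12}\bigl(x-2+x^{-1}\bigr)-\frac{\log^2x}{4}.$$ Let $L$ be the Rogers dilogarithm: $L(x)=\mathrm{Li}_2(x)+\frac12\log(x)\log(1-x)$ for $0\le x\le1$ (with the product of logarithms read as $0$ at the endpoints), where $\mathrm{Li}_2(x)=\sum_{m\ge1}x^m/m^2$, extended to $\mathbb R$ by $L(x)=\frac{\pi^2}{3}-L(1/x)$ for $x>1$ and $L(x)=-L\bigl(\frac{x}{x-1}\bigr)$ for $x<0$. For an integer $n\ge1$ let $\mathcal M_n$ be the set of $2\times2$ integer matrices of determinant $n$ modulo $\{\pm1\}$, and let $\mathcal R_n=\mathbb Q[\mathcal M_n]$, with multiplication $\mathcal R_m\times\mathcal R_n\to\mathcal R_{mn}$ induced by matrix multiplication. Put $S=\begin{pmatrix}0&-1\\1&0\end{pmatrix}$, $T=\begin{pmatrix}1&1\\0&1\end{pmatrix}$ and $T_n^\infty=\sum_{ad=n,\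 a,d>0}\ \sum_{0\le b<d}\begin{bmatrix}a&b\\0&d\end{bmatrix}\in\mathcal R_n$. An element $\widetilde T_n\in\mathcal R_n$ is said to act like the $n$-th Hecke operator on periods if $$(1-S)\widetilde T_n=T_n^\infty(1-S)+(1-T)Y\qquad\text{for some }Y\in\mathcal R_n.$$ Theorem. Let $n\ge1$ and suppose that $\widetilde T_n=\sum_\gamma\nu_\gamma\gamma\in\mathcal R_n$ acts like the $n$-th Hecke operator on periods and that every $\gamma$ with $\nu_\gamma\neq0$ is represented by a matrix with nonnegative entries. Then there is a constant $C\in\mathbb R$ such that for all $x>0$ $$\bigl(\mathcal F|_0\widetilde T_n\bigr)(x)-\sigma(n)\,\mathcal F(x)-\sum_{\gamma(\infty)\ne\infty}\nu_\gamma\,L\!\left(\frac{\gamma(x)}{\gamma(\infty)}\right)=A_n\log x+C,$$ where $\bigl(\mathcal F|_0\widetilde T_n\bigr)(x)=\sum_\gamma\nu_\gamma\mathcal F(\gamma(x))$, where $\gamma(x)=\frac{ax+b}{cx+d}$ and $\gamma(\infty)=\frac ac$ (equal to $\infty$ if $c=0$) for $\gamma=\begin{bmatrix}a&b\\c&d\end{bmatrix}$,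 where $\sigma(n)=\sum_{l\mid n}l$ over the positive divisors $l$ of $n$, and $A_n=\frac12\sum_{l\mid n}l\log(l^2/n)$. -/

import Mathlib

namespace HerglotzHecke

/-! ### The Herglotz function and the Rogers dilogarithm -/

/-- The digamma function `ψ = Γ' / Γ` of a real variable. -/
noncomputable def digamma (x : ℝ) : ℝ := deriv Real.Gamma x / Real.Gamma x

/-- The Herglotz function `F(x) = ∑_{n ≥ 1} (ψ(nx) - log(nx)) / n`, for `x > 0`. -/
noncomputable def herglotzF (x : ℝ) : ℝ :=
  ∑' m : ℕ, (digamma (((m : ℝ) + 1) * x) - Real.log (((m : ℝ) + 1) * x)) / ((m : ℝ) + 1)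

/-- The modified Herglotz function
`𝓕(x) = F(x) - F(1) + (π² / 12) (x - 2 + x⁻¹) - (log² x) / 4`, for `x > 0`. -/
noncomputable def modHerglotz (x : ℝ) : ℝ :=
  herglotzF x - herglotzF 1 + Real.pi ^ 2 / 12 * (x - 2 + x⁻¹) - Real.log x ^ 2 / 4

/-- Euler's dilogarithm `Li₂(x) = ∑_{n ≥ 1} xⁿ / n²`; only used for `0 ≤ x ≤ 1`. -/
noncomputable def dilog (x : ℝ) : ℝ :=
  ∑' m : ℕ, x ^ (m + 1) / ((m : ℝ) + 1) ^ 2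

/-- The Rogers dilogarithm on `[0, 1]` (the product of logarithms is `0` at both end points,
in agreement with its limits there). -/
noncomputable def rogersUnit (x : ℝ) : ℝ :=
  dilog x + 1 / 2 * Real.log x * Real.log (1 - x)

/-- The Rogers dilogarithm on the real line. -/
noncomputable def rogersL (x : ℝ) : ℝ :=
  if 1 < x then Real.pi ^ 2 / 3 - rogersUnit (1 / x)
  else if x < 0 then -rogersUnit (x / (x - 1))
  else rogersUnit x

/-! ### Integer matrices modulo sign and their monoid algebra -/

/-- The congruence `A ~ B ↔ A = B ∨ A = -B` on integer `2 × 2` matrices. -/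
def signCon : Con (Matrix (Fin 2) (Fin 2) ℤ) where
  r A B := A = B ∨ A = -B
  iseqv := by
    refine ⟨fun A => Or.inl rfl, ?_, ?_⟩
    · rintro A B (rfl | rfl)
      · exact Or.inl rfl
      · exact Or.inr (neg_neg _).symm
    · rintro A B C (rfl | rfl) (rfl | rfl)
      · exact Or.inl rfl
      · exact Or.inr rfl
      · exact Or.inr rfl
      · exact Or.inl (neg_neg _)
  mul' := by
    rintro A B C D (rfl | rfl) (rfl | rfl)
    · exact Or.inl rfl
    · exact Or.inr (by simp)
    · exact Or.inr (by simp)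
    · exact Or.inl (by simp)

/-- The monoid of integer `2 × 2` matrices modulo `±1`. -/
abbrev MatPM : Type := signCon.Quotient

/-- The class of the matrix with rows `(a, b)` and `(c, d)`. -/
def cls (a b c d : ℤ) : MatPM := ((!![a, b; c, d] : Matrix (Fin 2) (Fin 2) ℤ) : signCon.Quotient)

/-- The determinant of a class (well defined since the matrices are `2 × 2`). -/
def detPM (γ : MatPM) : ℤ :=
  Con.liftOn γ (fun A => A.det) (by
    rintro A B (rfl | rfl)
    · rfl
    · simp [Matrix.det_fin_two])

/-- The class has a representative all of whose entries are nonnegative. -/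
def IsNonneg (γ : MatPM) : Prop :=
  ∃ a b c d : ℤ, 0 ≤ a ∧ 0 ≤ b ∧ 0 ≤ c ∧ 0 ≤ d ∧ γ = cls a b c d

/-- The fractional linear action `γ(x) = (ax + b) / (cx + d)`, where `cx + d ≠ 0`. -/
noncomputable def moebius (γ : MatPM) (x : ℝ) : ℝ :=
  Con.liftOn γ
    (fun A => ((A 0 0 : ℝ) * x + (A 0 1 : ℝ)) / ((A 1 0 : ℝ) * x + (A 1 1 : ℝ))) (by
    rintro A B (rfl | rfl)
    · rfl
    · simp only [Matrix.neg_apply, Int.cast_neg, neg_mul, ← neg_add]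
      exact neg_div_neg_eq _ _)

/-- `γ(∞) ∈ ℙ¹(ℝ) = ℝ ∪ {∞}`: it is `∞` if `c = 0` and `a / c` otherwise. -/
noncomputable def imageInfty (γ : MatPM) : OnePoint ℝ :=
  Con.liftOn γ
    (fun A => if A 1 0 = 0 then OnePoint.infty
      else (((A 0 0 : ℝ) / (A 1 0 : ℝ) : ℝ) : OnePoint ℝ)) (by
    rintro A B (rfl | rfl)
    · rfl
    · simp only [Matrix.neg_apply, Int.cast_neg, neg_eq_zero, neg_div_neg_eq])

/-- The real number `y` with `γ(∞) = y`, if `γ(∞) ≠ ∞` (and `0` otherwise). -/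
noncomputable def imageInftyReal (γ : MatPM) : ℝ :=
  (imageInfty γ).elim 0 id

/-- The ring of formal rational linear combinations of integer matrices modulo `±1`. -/
abbrev MatRing : Type := MonoidAlgebra ℚ MatPM

/-- The basis element `[a b; c d]`. -/
noncomputable def bmat (a b c d : ℤ) : MatRing := MonoidAlgebra.single (cls a b c d) 1

/-- The elements of `ℚ[𝓜ₙ]`: only matrices of determinant `n` occur. -/
def InDegree (n : ℕ) (ξ : MatRing) : Prop :=
  ∀ γ ∈ ξ.coeff.support, detPM γ = (n : ℤ)

/-- The matrix `S`. -/
noncomputable def matS : MatRing := bmat 0 (-1) 1 0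

/-- The matrix `T`. -/
noncomputable def matT : MatRing := bmat 1 1 0 1

/-- `Tₙ^∞ = ∑_{ad = n} ∑_{0 ≤ b < d} [a b; 0 d]`. -/
noncomputable def heckeInfty (n : ℕ) : MatRing :=
  ∑ p ∈ n.divisorsAntidiagonal, ∑ b ∈ Finset.range p.2, bmat (p.1 : ℤ) (b : ℤ) 0 (p.2 : ℤ)

/-- `ξ ∈ ℚ[𝓜ₙ]` acts like the `n`-th Hecke operator on periods:
`(1 - S) ξ = Tₙ^∞ (1 - S) + (1 - T) Y` for some `Y ∈ ℚ[𝓜ₙ]`. -/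
def ActsLikeHecke (n : ℕ) (ξ : MatRing) : Prop :=
  InDegree n ξ ∧
    ∃ Y : MatRing, InDegree n Y ∧
      (1 - matS) * ξ = heckeInfty n * (1 - matS) + (1 - matT) * Y

/-- The weight `0` slash action `(f |₀ ∑ ν_γ γ)(x) = ∑ ν_γ f(γ(x))`. -/
noncomputable def slashZero (f : ℝ → ℝ) (ξ : MatRing) (x : ℝ) : ℝ :=
  ∑ γ ∈ ξ.coeff.support, (ξ.coeff γ : ℝ) * f (moebius γ x)

open Classical in
/-- The sum `∑_{γ(∞) ≠ ∞} ν_γ L(γ(x) / γ(∞))`. -/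
noncomputable def rogersSum (ξ : MatRing) (x : ℝ) : ℝ :=
  ∑ γ ∈ ξ.coeff.support with imageInfty γ ≠ OnePoint.infty,
    (ξ.coeff γ : ℝ) * rogersL (moebius γ x / imageInftyReal γ)

/-- `Aₙ = (1/2) ∑_{l ∣ n} l log(l² / n)`. -/
noncomputable def constA (n : ℕ) : ℝ :=
  1 / 2 * ∑ l ∈ n.divisors, (l : ℝ) * Real.log ((l : ℝ) ^ 2 / (n : ℝ))

end HerglotzHecke

/-!
The idea is to exhibit the derivative of `𝓕` as a lattice sum over the positive quadrant, and to
read the defining relation of `T̃ₙ` as an identity between lattice sums over cones.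

*A lattice point identity.* A function `h` on matrices with `h(Tγ) = h(γ)` can be paired with
`(1 - S) T̃ₙ = Tₙ^∞ (1 - S) + (1 - T) Y`; the unknown `Y` disappears, and `∑ ν_γ (h(γ) - h(Sγ))`
is computed from the upper triangular matrices alone (`ActsLikeHecke.sum_sub`). For a vector
`p = (m, k)` of `ℤ²`, take for `h(γ)` the sign of the first coordinate of `p γ⁻¹` if `p γ⁻¹` is
integral, and `0` otherwise (with a further sign that makes it even). On matrices with nonnegative
entries `h(γ) - h(Sγ)` is then twice the weight of `p` in the cone spanned by the rows of `γ`
(weight `1` inside, `1/2` on the boundary rays), with respect to the lattice generated by these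
rows. Since the sublattices of index `n` containing `p` number `∑ l` over the common divisors `l` of
`n`, `m`, `k` (`sum_card_sublattices`), summation against `exp (-(m u + k v))` yields
`∑ ν_γ Q(γ(u, v)) = ∑_{l ∣ n} l Q(l u, l v)`, where `Q` is the generating function of the positive
quadrant (`ActsLikeHecke.sum_quadSum`).

*The derivative of `𝓕`.* From `ψ(y) - log y = ∑ (log (y + n + 1) - log (y + n) - 1 / (y + n))` the
derivative of `F` is a Laplace type integral (`hasDerivAt_herglotzF`), and the integral of
`t Q(t u, t v)` over `(ε, ∞)` diverges like `-2 log ε / (u v)` with finite part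
`2 v⁻² 𝓕'(u / v) - log (u v) / (u v)` (`tendsto_integral_mul_quadSum`). So the identity for `Q`
becomes one for `𝓕'` (`ActsLikeHecke.sum_modHerglotzDeriv`), with an additional logarithmic term
`n log (U V) / (2 U V)`, `U = a x + b`, `V = c x + d`, for each `γ`.

*The dilogarithms.* The derivative of `L(γ(x) / γ(∞))` equals this logarithmic term up to
`(E(c, d) - E(a, b)) / 2`, where `E(c, d)` depends only on the cusp `-d / c`
(`NatReps.hasDerivAt_rogersL_moebius`). As `γ ↦ E(c, d)` is again `T`-invariant, the sum of these
corrections is explicit (`ActsLikeHecke.sum_rowLog`). Hence the difference of the two sides of the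
theorem has derivative `0` on `(0, ∞)`.
-/

namespace HerglotzHecke

/-! ### Pairing with functions invariant under translation -/

/-- The additive extension to `ℚ[𝓜]` of a real function on matrix classes. -/
noncomputable def pairing (h : MatPM → ℝ) : MatRing →+ ℝ :=
  (Finsupp.liftAddHom fun γ => (AddMonoidHom.mulRight (h γ)).comp
    (Rat.castHom ℝ).toAddMonoidHom).comp MonoidAlgebra.coeffAddEquiv.toAddMonoidHom

theorem pairing_apply (h : MatPM → ℝ) (ξ : MatRing) :
    pairing h ξ = ∑ γ ∈ ξ.coeff.support, (ξ.coeff γ : ℝ) * h γ := by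
  simp [pairing, Finsupp.sum]

theorem pairing_single (h : MatPM → ℝ) (γ : MatPM) (r : ℚ) :
    pairing h (MonoidAlgebra.single γ r) = r * h γ := by
  simp [pairing]

theorem pairing_single_mul (h : MatPM → ℝ) (g : MatPM) (ξ : MatRing) :
    pairing h (MonoidAlgebra.single g 1 * ξ) = pairing (fun γ => h (g * γ)) ξ := by
  induction ξ using MonoidAlgebra.induction_linear with
  | zero => simp
  | add f g hf hg => simp only [mul_add, map_add, hf, hg]
  | single γ r => simp [pairing_single, MonoidAlgebra.single_mul_single]

theorem cls_mul (a b c d a' b' c' d' : ℤ) :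
    cls a b c d * cls a' b' c' d' =
      cls (a * a' + b * c') (a * b' + b * d') (c * a' + d * c') (c * b' + d * d') := by
  unfold cls
  rw [← Con.coe_mul, Matrix.mul_fin_two]

theorem exists_eq_cls (γ : MatPM) : ∃ a b c d : ℤ, γ = cls a b c d := by
  induction γ using Con.induction_on with
  | H A => exact ⟨A 0 0, A 0 1, A 1 0, A 1 1, by unfold cls; rw [← Matrix.eta_fin_two A]⟩

/-- A function of the four entries that is invariant under a change of sign of all of them,
as a function on matrix classes. -/
noncomputable def entryFun (f : ℤ → ℤ → ℤ → ℤ → ℝ)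
    (hf : ∀ a b c d, f (-a) (-b) (-c) (-d) = f a b c d) (γ : MatPM) : ℝ :=
  Con.liftOn γ (fun A => f (A 0 0) (A 0 1) (A 1 0) (A 1 1)) (by
    rintro A B (rfl | rfl)
    · rfl
    · simp only [Matrix.neg_apply, hf])

@[simp]
theorem entryFun_cls (f : ℤ → ℤ → ℤ → ℤ → ℝ)
    (hf : ∀ a b c d, f (-a) (-b) (-c) (-d) = f a b c d) (a b c d : ℤ) :
    entryFun f hf (cls a b c d) = f a b c d := rfl

@[simp]
theorem detPM_cls (a b c d : ℤ) : detPM (cls a b c d) = a * d - b * c :=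
  Matrix.det_fin_two_of a b c d

@[simp]
theorem moebius_cls (a b c d : ℤ) (x : ℝ) :
    moebius (cls a b c d) x = (a * x + b) / (c * x + d) := rfl

theorem imageInfty_cls (a b c d : ℤ) :
    imageInfty (cls a b c d) = if c = 0 then OnePoint.infty else (((a : ℝ) / c : ℝ) : OnePoint ℝ) :=
  rfl

/-- A `T`-invariant function `f` of matrices turns the defining relation of an element acting
like the `n`-th Hecke operator into a numerical identity: `f|(1 - S)` has the same value on that
element as `f` has on `Tₙ^∞ (1 - S)`. -/
theorem ActsLikeHecke.sum_sub {n : ℕ} {ξ : MatRing} (hξ : ActsLikeHecke n ξ)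
    (f : ℤ → ℤ → ℤ → ℤ → ℝ) (hf : ∀ a b c d, f (-a) (-b) (-c) (-d) = f a b c d)
    (hT : ∀ a b c d, f (a + c) (b + d) c d = f a b c d) :
    ∑ γ ∈ ξ.coeff.support, (ξ.coeff γ : ℝ) *
        (entryFun f hf γ - entryFun f hf (cls 0 (-1) 1 0 * γ)) =
      ∑ p ∈ n.divisorsAntidiagonal, ∑ b ∈ Finset.range p.2,
        (f p.1 b 0 p.2 - f b (-p.1) p.2 0) := by
  obtain ⟨-, Y, -, hY⟩ := hξ
  have key := congrArg (pairing (entryFun f hf)) hY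
  have h1 : pairing (entryFun f hf) ((1 - matT) * Y) = 0 := by
    rw [sub_mul, one_mul, map_sub, matT, bmat, pairing_single_mul, sub_eq_zero]
    congr 2
    funext γ
    obtain ⟨a, b, c, d, rfl⟩ := exists_eq_cls γ
    rw [cls_mul]
    simp [hT]
  have h2 : pairing (entryFun f hf) ((1 - matS) * ξ) = ∑ γ ∈ ξ.coeff.support, (ξ.coeff γ : ℝ) *
        (entryFun f hf γ - entryFun f hf (cls 0 (-1) 1 0 * γ)) := by
    rw [sub_mul, one_mul, map_sub, matS, bmat, pairing_single_mul, pairing_apply, pairing_apply,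
      ← Finset.sum_sub_distrib]
    simp only [mul_sub]
  rw [← h2, key, map_add, h1, add_zero, heckeInfty, Finset.sum_mul, map_sum]
  refine Finset.sum_congr rfl fun p _ => ?_
  rw [Finset.sum_mul, map_sum]
  refine Finset.sum_congr rfl fun b _ => ?_
  rw [mul_sub, mul_one, map_sub, matS, bmat, bmat, MonoidAlgebra.single_mul_single, pairing_single,
    pairing_single, cls_mul]
  simp

/-! ### Sublattices and cone weights -/

/-- The residues `b` modulo `d` with `m b ≡ k` modulo `d`: there are `gcd(d, m)` of them
if `gcd(d, m)` divides `k`, and none otherwise. -/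
theorem card_linear_congruence {d : ℕ} (hd : 0 < d) (m k : ℤ) :
    ((Finset.range d).filter fun b : ℕ => (d : ℤ) ∣ k - m * b).card =
      if (Int.gcd d m : ℤ) ∣ k then Int.gcd d m else 0 := by
  set g := Int.gcd d m with hg
  have hg0 : 0 < g := Int.gcd_pos_of_ne_zero_left _ (by positivity)
  split_ifs with h
  · obtain ⟨d', hd'⟩ : (g : ℤ) ∣ d := Int.gcd_dvd_left ..
    obtain ⟨m', hm'⟩ : (g : ℤ) ∣ m := Int.gcd_dvd_right ..
    obtain ⟨k', rfl⟩ := h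
    have hgz : (g : ℤ) ≠ 0 := by positivity
    have hd'0 : 0 < d' := by
      by_contra hle
      have : (g : ℤ) * d' ≤ 0 := mul_nonpos_of_nonneg_of_nonpos (by positivity) (by omega)
      omega
    have hcop : IsCoprime d' m' := by
      obtain ⟨u, v, huv⟩ : ∃ u v : ℤ, (g : ℤ) = d * u + m * v := ⟨_, _, Int.gcd_eq_gcd_ab d m⟩
      refine ⟨u, v, mul_left_cancel₀ hgz ?_⟩
      calc (g : ℤ) * (u * d' + v * m') = (g * d') * u + (g * m') * v := by ring
        _ = g * 1 := by rw [← hd', ← hm', ← huv, mul_one]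
    obtain ⟨u, v, huv⟩ := hcop
    -- `v k'` is a solution, and all others are congruent to it modulo `d' = d / g`
    have hiff : ∀ b : ℕ, ((d : ℤ) ∣ g * k' - m * b) ↔ (b : ℤ) ≡ v * k' [ZMOD d'] := by
      intro b
      rw [hd', hm', mul_assoc, ← mul_sub, mul_dvd_mul_iff_left hgz, Int.modEq_comm,
        Int.modEq_iff_dvd]
      constructor
      · rintro ⟨w, hw⟩
        exact ⟨u * b - v * w, by linear_combination (-(b : ℤ)) * huv - v * hw⟩
      · rintro ⟨w, hw⟩
        exact ⟨u * k' - m' * w, by linear_combination (-k') * huv - m' * hw⟩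
    lift d' to ℕ using hd'0.le
    have hdn : d = g * d' := by exact_mod_cast hd'
    have hr : (Finset.range d).filter (fun b : ℕ => (d : ℤ) ∣ g * k' - m * b) =
        (Finset.range d).filter (fun b : ℕ => b ≡ ((v * k') % d').toNat [MOD d']) := by
      refine Finset.filter_congr fun b _ => ?_
      rw [hiff, ← Int.natCast_modEq_iff, Int.toNat_of_nonneg (Int.emod_nonneg _ hd'0.ne')]
      exact ⟨fun h => h.trans (Int.mod_modEq _ _).symm, fun h => h.trans (Int.mod_modEq _ _)⟩
    rw [hr, ← Nat.count_eq_card_filter_range, hdn,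
      Nat.count_modEq_card _ (by exact_mod_cast hd'0)]
    have : 0 < d' := by exact_mod_cast hd'0
    simp [this]
  · rw [Finset.card_eq_zero, Finset.filter_eq_empty_iff]
    intro b _ hb
    exact h ((dvd_sub_left ((Int.gcd_dvd_right (d : ℤ) m).mul_right _)).1
      ((Int.gcd_dvd_left (d : ℤ) m).trans hb))

/-- The sublattices of `ℤ²` of index `n` that contain a given vector `(m, k)`, each described by
its Hermite normal form, number `∑ l` over the common divisors `l` of `n`, `m` and `k`. -/
theorem sum_card_sublattices {n : ℕ} (hn : 0 < n) (m k : ℤ) :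
    ∑ p ∈ n.divisorsAntidiagonal, ((Finset.range p.2).filter fun b : ℕ =>
        (n : ℤ) ∣ m * p.2 ∧ (n : ℤ) ∣ k * p.1 - m * b).card =
      ∑ l ∈ n.divisors.filter fun l : ℕ => (l : ℤ) ∣ m ∧ (l : ℤ) ∣ k, l := by
  set G := Int.gcd n m with hG
  have hG0 : 0 < G := Int.gcd_pos_of_ne_zero_left _ (by positivity)
  have hGn : G ∣ n := by exact_mod_cast (Int.gcd_dvd_left (n : ℤ) m)
  -- for `a d = n`, there are solutions only if `a ∣ G`, and then `gcd (d, m / a) = G / a`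
  have hterm : ∀ p ∈ n.divisorsAntidiagonal, ((Finset.range p.2).filter fun b : ℕ =>
        (n : ℤ) ∣ m * p.2 ∧ (n : ℤ) ∣ k * p.1 - m * b).card =
      if p.1 ∣ G then (if ((G / p.1 : ℕ) : ℤ) ∣ k then G / p.1 else 0) else 0 := by
    rintro ⟨a, d⟩ hp
    obtain ⟨had, -⟩ := Nat.mem_divisorsAntidiagonal.1 hp
    dsimp only at had ⊢
    have ha : 0 < a := Nat.pos_of_ne_zero (by rintro rfl; omega)
    have hd : 0 < d := Nat.pos_of_ne_zero (by rintro rfl; omega)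
    have haz : (a : ℤ) ≠ 0 := by positivity
    have hdz : (d : ℤ) ≠ 0 := by positivity
    have hnz : (n : ℤ) = a * d := by exact_mod_cast had.symm
    have hiff : (n : ℤ) ∣ m * d ↔ a ∣ G := by
      rw [hnz, mul_dvd_mul_iff_right hdz, ← Int.natCast_dvd_natCast, hG, Int.dvd_coe_gcd_iff]
      exact ⟨fun h => ⟨⟨d, hnz⟩, h⟩, fun h => h.2⟩
    by_cases haG : a ∣ G
    · rw [if_pos haG]
      obtain ⟨m1, rfl⟩ : (a : ℤ) ∣ m := by
        rw [← Int.natCast_dvd_natCast, hG, Int.dvd_coe_gcd_iff] at haG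
        exact haG.2
      have hGa : G / a = Int.gcd d m1 := by
        rw [hG, hnz, Int.gcd_mul_left, Int.natAbs_natCast, Nat.mul_div_cancel_left _ ha]
      rw [hGa, ← card_linear_congruence hd]
      congr 1
      refine Finset.filter_congr fun b _ => ?_
      rw [and_iff_right (hiff.2 haG), hnz,
        show k * a - a * m1 * b = a * (k - m1 * b) by ring, mul_dvd_mul_iff_left haz]
    · rw [if_neg haG, Finset.card_eq_zero, Finset.filter_eq_empty_iff]
      exact fun b _ hb => haG (hiff.1 hb.1)
  rw [Finset.sum_congr rfl hterm, Nat.sum_divisorsAntidiagonal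
    (f := fun a _ => if a ∣ G then (if ((G / a : ℕ) : ℤ) ∣ k then G / a else 0) else 0),
    ← Finset.sum_filter]
  have h1 : n.divisors.filter (fun a => a ∣ G) = G.divisors := by
    ext a
    simp only [Finset.mem_filter, Nat.mem_divisors]
    exact ⟨fun h => ⟨h.2, hG0.ne'⟩, fun h => ⟨⟨h.1.trans hGn, hn.ne'⟩, h.1⟩⟩
  rw [h1, Nat.sum_div_divisors G (fun l => if ((l : ℕ) : ℤ) ∣ k then l else 0),
    ← Finset.sum_filter]
  refine Finset.sum_congr ?_ fun _ _ => rfl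
  ext l
  simp only [Finset.mem_filter, Nat.mem_divisors]
  have hl : l ∣ G ↔ l ∣ n ∧ (l : ℤ) ∣ m := by
    rw [← Int.natCast_dvd_natCast, hG, Int.dvd_coe_gcd_iff, Int.natCast_dvd_natCast]
  rw [hl]
  constructor
  · rintro ⟨⟨⟨h1, h2⟩, -⟩, h3⟩
    exact ⟨⟨h1, hn.ne'⟩, h2, h3⟩
  · rintro ⟨⟨h1, -⟩, h2, h3⟩
    exact ⟨⟨⟨h1, h2⟩, hG0.ne'⟩, h3⟩

/-- For a matrix `(a, b; c, d)` of determinant `n` with nonnegative entries and an integral row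
vector `p = (m, k)`, twice the weight of `p` in the cone spanned by the rows of the matrix, relative
to the lattice generated by these rows: it is `0` unless `p = r₁ (a, b) + r₂ (c, d)` with integers
`r₁`, `r₂`, and then it is `sign r₁ + sign r₂`. -/
noncomputable def coneWeight (n : ℕ) (m k a b c d : ℤ) : ℝ :=
  if (n : ℤ) ∣ m * d - k * c ∧ (n : ℤ) ∣ k * a - m * b then
    (((m * d - k * c).sign + (k * a - m * b).sign : ℤ) : ℝ) else 0

/-- The `T`-invariant function of matrices whose image under `1 - S` is the cone weight (see
`halfWeight_sub`). For determinant `n`, `(m d - k c, k a - m b)` is `n p γ⁻¹`, and only the sign of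
its first coordinate enters. The factor `sign (c + d)`, the sign of the second coordinate of
`γ (1, 1)`, makes the function even in `γ`, and it equals `1` on matrices with nonnegative
entries. -/
noncomputable def halfWeight (n : ℕ) (m k a b c d : ℤ) : ℝ :=
  if (n : ℤ) ∣ m * d - k * c ∧ (n : ℤ) ∣ k * a - m * b then
    (((m * d - k * c).sign * (c + d).sign : ℤ) : ℝ) else 0

theorem halfWeight_neg (n : ℕ) (m k a b c d : ℤ) :
    halfWeight n m k (-a) (-b) (-c) (-d) = halfWeight n m k a b c d := by
  unfold halfWeight
  rw [show m * -d - k * -c = -(m * d - k * c) by ring,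
    show k * -a - m * -b = -(k * a - m * b) by ring, show -c + -d = -(c + d) by ring]
  simp only [dvd_neg, Int.sign_neg, neg_mul_neg]

theorem halfWeight_add (n : ℕ) (m k a b c d : ℤ) :
    halfWeight n m k (a + c) (b + d) c d = halfWeight n m k a b c d := by
  unfold halfWeight
  rw [show k * (a + c) - m * (b + d) = (k * a - m * b) - (m * d - k * c) by ring]
  congr 1
  exact propext (and_congr_right fun h => dvd_sub_left h)

/-- For an element acting like a Hecke operator, the weighted cones spanned by the rows of its
matrices add up, at every lattice point `(m, k)`, to the corresponding sum for the positive quadrant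
over all sublattices of index `n`. By `halfWeight_sub` the differences on the left are the cone
weights when the entries are nonnegative. -/
theorem ActsLikeHecke.sum_halfWeight_sub {n : ℕ} (hn : 0 < n) {ξ : MatRing} (hξ : ActsLikeHecke n ξ)
    (m k : ℤ) :
    ∑ γ ∈ ξ.coeff.support, (ξ.coeff γ : ℝ) *
        (entryFun (halfWeight n m k) (halfWeight_neg n m k) γ -
          entryFun (halfWeight n m k) (halfWeight_neg n m k) (cls 0 (-1) 1 0 * γ)) =
      (∑ l ∈ n.divisors.filter fun l : ℕ => (l : ℤ) ∣ m ∧ (l : ℤ) ∣ k, (l : ℝ)) *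
        ((m.sign + k.sign : ℤ) : ℝ) := by
  rw [hξ.sum_sub _ (halfWeight_neg n m k) (halfWeight_add n m k)]
  have h1 : ∀ p ∈ n.divisorsAntidiagonal, ∑ b ∈ Finset.range p.2,
        (halfWeight n m k p.1 b 0 p.2 - halfWeight n m k b (-p.1) p.2 0) =
      (((Finset.range p.2).filter fun b : ℕ =>
        (n : ℤ) ∣ m * p.2 ∧ (n : ℤ) ∣ k * p.1 - m * b).card : ℝ) * (m.sign : ℝ) +
      (((Finset.range p.2).filter fun b : ℕ =>
        (n : ℤ) ∣ (-k) * p.2 ∧ (n : ℤ) ∣ m * p.1 - (-k) * b).card : ℝ) * (k.sign : ℝ) := by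
    rintro ⟨a, d⟩ hp
    obtain ⟨had, -⟩ := Nat.mem_divisorsAntidiagonal.1 hp
    dsimp only at had ⊢
    have hd : 0 < d := Nat.pos_of_ne_zero (by rintro rfl; omega)
    have hds : (d : ℤ).sign = 1 := Int.sign_eq_one_of_pos (by positivity)
    rw [Finset.sum_sub_distrib, sub_eq_add_neg, ← Finset.sum_neg_distrib,
      Finset.natCast_card_filter, Finset.natCast_card_filter, Finset.sum_mul, Finset.sum_mul]
    congr 1
    · refine Finset.sum_congr rfl fun b _ => ?_
      simp only [halfWeight, mul_zero, sub_zero, zero_add, Int.sign_mul, hds, mul_one, ite_mul,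
        one_mul, zero_mul]
    · refine Finset.sum_congr rfl fun b _ => ?_
      unfold halfWeight
      rw [show m * 0 - k * (d : ℤ) = -k * d by ring,
        show k * (b : ℤ) - m * -(a : ℤ) = m * a - -k * b by ring]
      simp only [add_zero, Int.sign_mul, hds, mul_one, ite_mul, one_mul, zero_mul, Int.sign_neg]
      split_ifs <;> simp
  rw [Finset.sum_congr rfl h1, Finset.sum_add_distrib, ← Finset.sum_mul, ← Finset.sum_mul,
    ← Nat.cast_sum, ← Nat.cast_sum, sum_card_sublattices hn, sum_card_sublattices hn]
  simp only [Int.dvd_neg, and_comm (a := _ ∣ k)]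
  push_cast
  ring

/-- On matrices with nonnegative entries, `halfWeight|(1 - S)` is the cone weight. -/
theorem halfWeight_sub {n : ℕ} (hn : 0 < n) (m k : ℤ) (a b c d : ℕ)
    (hdet : (a : ℤ) * d - b * c = n) :
    entryFun (halfWeight n m k) (halfWeight_neg n m k) (cls a b c d) -
      entryFun (halfWeight n m k) (halfWeight_neg n m k) (cls 0 (-1) 1 0 * cls a b c d) =
      coneWeight n m k a b c d := by
  have had : (0 : ℤ) < a * d := by
    have : (0 : ℤ) ≤ b * c := by positivity
    omega
  have ha : (0 : ℤ) < a := pos_of_mul_pos_left had (by positivity)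
  have hd : (0 : ℤ) < d := pos_of_mul_pos_right had (by positivity)
  rw [cls_mul, entryFun_cls, entryFun_cls]
  simp only [zero_mul, zero_add, one_mul, add_zero, neg_mul]
  unfold halfWeight coneWeight
  rw [Int.sign_eq_one_of_pos (show (0 : ℤ) < c + d by positivity),
    Int.sign_eq_one_of_pos (show (0 : ℤ) < a + b by positivity),
    show m * (b : ℤ) - k * a = -(k * a - m * b) by ring,
    show k * -(c : ℤ) - m * -(d : ℤ) = m * d - k * c by ring, Int.sign_neg]
  simp only [dvd_neg, and_comm (a := (n : ℤ) ∣ k * a - m * b)]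
  split_ifs <;> simp

/-- A class in degree `n` with a nonnegative representative has one with natural entries. -/
theorem IsNonneg.exists_nat {n : ℕ} {γ : MatPM} (h : IsNonneg γ) (hdet : detPM γ = n) :
    ∃ a b c d : ℕ, γ = cls a b c d ∧ (a : ℤ) * d - b * c = n := by
  obtain ⟨a, b, c, d, ha, hb, hc, hd, rfl⟩ := h
  lift a to ℕ using ha
  lift b to ℕ using hb
  lift c to ℕ using hc
  lift d to ℕ using hd
  exact ⟨a, b, c, d, rfl, by rw [← hdet, detPM_cls]⟩

/-! ### Lattice points in cones: generating functions -/

/-- The sum of `(sign i + sign j) exp (-(i u + j v))` over `i, j ≥ 0`, in closed form. -/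
noncomputable def quadSum (u v : ℝ) : ℝ :=
  (Real.exp (-u) + Real.exp (-v)) / ((1 - Real.exp (-u)) * (1 - Real.exp (-v)))

theorem hasSum_exp_neg_mul {u : ℝ} (hu : 0 < u) :
    HasSum (fun i : ℕ => Real.exp (-(i * u))) (1 - Real.exp (-u))⁻¹ := by
  have h := hasSum_geometric_of_lt_one (Real.exp_pos (-u)).le
    (Real.exp_lt_one_iff.2 (neg_lt_zero.2 hu))
  refine h.congr_fun fun i => ?_
  rw [← Real.exp_nat_mul]
  congr 1
  ring

theorem hasSum_sign_mul_exp_neg_mul {u : ℝ} (hu : 0 < u) :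
    HasSum (fun i : ℕ => (((i : ℤ).sign : ℤ) : ℝ) * Real.exp (-(i * u)))
      (Real.exp (-u) * (1 - Real.exp (-u))⁻¹) := by
  rw [← hasSum_nat_add_iff' 1]
  simp only [Finset.range_one, Finset.sum_singleton, Nat.cast_zero, Int.sign_zero, Int.cast_zero,
    zero_mul, sub_zero]
  refine ((hasSum_exp_neg_mul hu).mul_left (Real.exp (-u))).congr_fun fun i => ?_
  rw [Int.sign_eq_one_of_pos (by positivity), ← Real.exp_add]
  push_cast
  rw [one_mul]
  congr 1
  ring

theorem hasSum_quadSum {u v : ℝ} (hu : 0 < u) (hv : 0 < v) :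
    HasSum (fun p : ℕ × ℕ => (((p.1 : ℤ).sign + (p.2 : ℤ).sign : ℤ) : ℝ) *
      Real.exp (-(p.1 * u + p.2 * v))) (quadSum u v) := by
  have hs : ∀ i : ℕ, (0 : ℝ) ≤ (((i : ℤ).sign : ℤ) : ℝ) := fun i => by
    exact_mod_cast Int.sign_nonneg_iff.2 (Int.natCast_nonneg i)
  have e1 := hasSum_exp_neg_mul hu
  have e2 := hasSum_exp_neg_mul hv
  have s1 := hasSum_sign_mul_exp_neg_mul hu
  have s2 := hasSum_sign_mul_exp_neg_mul hv
  have h1 := s1.mul e2 (s1.summable.mul_of_nonneg e2.summable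
    (fun i => mul_nonneg (hs i) (Real.exp_pos _).le) fun i => (Real.exp_pos _).le)
  have h2 := e1.mul s2 (e1.summable.mul_of_nonneg s2.summable
    (fun i => (Real.exp_pos _).le) fun i => mul_nonneg (hs i) (Real.exp_pos _).le)
  have hne : ∀ w : ℝ, 0 < w → 1 - Real.exp (-w) ≠ 0 := fun w hw =>
    (sub_pos.2 (Real.exp_lt_one_iff.2 (neg_lt_zero.2 hw))).ne'
  have hu' := hne u hu
  have hv' := hne v hv
  have hval : quadSum u v = Real.exp (-u) * (1 - Real.exp (-u))⁻¹ * (1 - Real.exp (-v))⁻¹ +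
      (1 - Real.exp (-u))⁻¹ * (Real.exp (-v) * (1 - Real.exp (-v))⁻¹) := by
    unfold quadSum
    field_simp
  rw [hval]
  refine (h1.add h2).congr_fun fun p => ?_
  rw [neg_add, Real.exp_add]
  push_cast
  ring

/-- Summing the cone weight of a matrix against an exponential: only the vectors `r₁ (a, b) +
r₂ (c, d)` with integers `r₁, r₂ ≥ 0` contribute. -/
theorem hasSum_coneWeight {n : ℕ} (hn : 0 < n) {a b c d : ℕ} (hdet : (a : ℤ) * d - b * c = n)
    {u v : ℝ} (hu : 0 < u) (hv : 0 < v) :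
    HasSum (fun p : ℕ × ℕ => coneWeight n p.1 p.2 a b c d * Real.exp (-(p.1 * u + p.2 * v)))
      (quadSum (a * u + b * v) (c * u + d * v)) := by
  have had : (0 : ℤ) < a * d := by
    have : (0 : ℤ) ≤ b * c := by positivity
    omega
  have ha : (0 : ℤ) < a := pos_of_mul_pos_left had (by positivity)
  have hd : (0 : ℤ) < d := pos_of_mul_pos_right had (by positivity)
  have hnz : (0 : ℤ) < n := by exact_mod_cast hn
  have ha' : (0 : ℝ) < a := by exact_mod_cast ha
  have hd' : (0 : ℝ) < d := by exact_mod_cast hd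
  let g : ℕ × ℕ → ℕ × ℕ := fun r => (r.1 * a + r.2 * c, r.1 * b + r.2 * d)
  have hq1 : ∀ r : ℕ × ℕ, ((g r).1 : ℤ) * d - (g r).2 * c = n * r.1 := fun r => by
    simp only [g]; push_cast; rw [← hdet]; ring
  have hq2 : ∀ r : ℕ × ℕ, ((g r).2 : ℤ) * a - (g r).1 * b = n * r.2 := fun r => by
    simp only [g]; push_cast; rw [← hdet]; ring
  have hg : Function.Injective g := by
    intro r s hrs
    have h1 := hq1 r
    have h2 := hq2 r
    rw [hrs, hq1 s] at h1
    rw [hrs, hq2 s] at h2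
    have h1' := mul_left_cancel₀ hnz.ne' h1
    have h2' := mul_left_cancel₀ hnz.ne' h2
    exact Prod.ext (by exact_mod_cast h1'.symm) (by exact_mod_cast h2'.symm)
  rw [← hg.hasSum_iff]
  · refine (hasSum_quadSum (u := a * u + b * v) (v := c * u + d * v) (by positivity)
      (by positivity)).congr_fun fun r => ?_
    simp only [Function.comp_apply, coneWeight]
    rw [hq1, hq2, if_pos ⟨dvd_mul_right _ _, dvd_mul_right _ _⟩, Int.sign_mul, Int.sign_mul,
      Int.sign_eq_one_of_pos hnz, one_mul, one_mul]
    congr 2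
    simp only [g]
    push_cast
    ring
  · rintro ⟨m, k⟩ hp
    refine mul_eq_zero_of_left ?_ _
    -- a nonzero weight forces `(m, k) = r₁ (a, b) + r₂ (c, d)` with `r₁, r₂` integral, and neither
    -- can be negative: opposite signs have weight `0`, and `r₁, r₂ ≤ 0` gives a negative coordinate
    by_contra hne
    dsimp only [coneWeight] at hne
    rw [ite_eq_right_iff, Classical.not_imp] at hne
    obtain ⟨⟨⟨r₁, h1⟩, ⟨r₂, h2⟩⟩, hs⟩ := hne
    rw [h1, h2, Int.sign_mul, Int.sign_mul, Int.sign_eq_one_of_pos hnz, one_mul, one_mul,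
      ← ne_eq, Int.cast_ne_zero] at hs
    have hm : (m : ℤ) = r₁ * a + r₂ * c := mul_left_cancel₀ hnz.ne' (by
      calc (n : ℤ) * m = (m * d - k * c) * a + (k * a - m * b) * c := by rw [← hdet]; ring
        _ = _ := by rw [h1, h2]; ring)
    have hk : (k : ℤ) = r₁ * b + r₂ * d := mul_left_cancel₀ hnz.ne' (by
      calc (n : ℤ) * k = (m * d - k * c) * b + (k * a - m * b) * d := by rw [← hdet]; ring
        _ = _ := by rw [h1, h2]; ring)
    have hc : (0 : ℤ) ≤ c := by positivity
    have hb : (0 : ℤ) ≤ b := by positivity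
    have hr₁ : 0 ≤ r₁ := by
      by_contra! hr
      rcases le_or_gt r₂ 0 with h | h
      · have := mul_nonpos_of_nonpos_of_nonneg h hc
        have := mul_neg_of_neg_of_pos hr ha
        omega
      · exact hs (by rw [Int.sign_eq_neg_one_of_neg hr, Int.sign_eq_one_of_pos h]; rfl)
    have hr₂ : 0 ≤ r₂ := by
      by_contra! hr
      rcases le_or_gt r₁ 0 with h | h
      · have := mul_nonpos_of_nonpos_of_nonneg h hb
        have := mul_neg_of_neg_of_pos hr hd
        omega
      · exact hs (by rw [Int.sign_eq_neg_one_of_neg hr, Int.sign_eq_one_of_pos h]; rfl)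
    lift r₁ to ℕ using hr₁
    lift r₂ to ℕ using hr₂
    exact hp ⟨(r₁, r₂), Prod.ext (by exact_mod_cast hm.symm) (by exact_mod_cast hk.symm)⟩

/-- The sum over the quadrant restricted to the sublattice `l ℤ²`. -/
theorem hasSum_quadrant_dvd {l : ℕ} (hl : 0 < l) {u v : ℝ} (hu : 0 < u) (hv : 0 < v) :
    HasSum (fun p : ℕ × ℕ => if ((l : ℤ) ∣ p.1 ∧ (l : ℤ) ∣ p.2) then
      (l : ℝ) * ((((p.1 : ℤ).sign + (p.2 : ℤ).sign : ℤ) : ℝ) *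
        Real.exp (-(p.1 * u + p.2 * v))) else 0) (l * quadSum (l * u) (l * v)) := by
  let g : ℕ × ℕ → ℕ × ℕ := fun r => (l * r.1, l * r.2)
  have hg : Function.Injective g := by
    rintro ⟨a, b⟩ ⟨c, d⟩ h
    obtain ⟨h1, h2⟩ := Prod.ext_iff.1 h
    exact Prod.ext (Nat.eq_of_mul_eq_mul_left hl h1) (Nat.eq_of_mul_eq_mul_left hl h2)
  rw [← hg.hasSum_iff]
  · refine ((hasSum_quadSum (u := l * u) (v := l * v) (by positivity)
      (by positivity)).mul_left (l : ℝ)).congr_fun fun r => ?_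
    simp only [Function.comp_apply, g]
    rw [if_pos (by push_cast; exact ⟨dvd_mul_right _ _, dvd_mul_right _ _⟩)]
    push_cast
    rw [Int.sign_mul, Int.sign_mul, Int.sign_eq_one_of_pos (show (0 : ℤ) < l by exact_mod_cast hl),
      one_mul, one_mul]
    congr 3
    ring
  · rintro ⟨m, k⟩ hp
    refine if_neg ?_
    rintro ⟨h1, h2⟩
    obtain ⟨a, rfl⟩ := Int.natCast_dvd_natCast.1 h1
    obtain ⟨b, rfl⟩ := Int.natCast_dvd_natCast.1 h2
    exact hp ⟨(a, b), rfl⟩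

/-- A choice of representatives with natural entries for the matrices occurring in `ξ`. -/
structure NatReps (n : ℕ) (ξ : MatRing) where
  /-- upper left entries -/
  a : MatPM → ℕ
  /-- upper right entries -/
  b : MatPM → ℕ
  /-- lower left entries -/
  c : MatPM → ℕ
  /-- lower right entries -/
  d : MatPM → ℕ
  eq_cls : ∀ γ ∈ ξ.coeff.support, γ = cls (a γ) (b γ) (c γ) (d γ)
  det : ∀ γ ∈ ξ.coeff.support, (a γ : ℤ) * d γ - b γ * c γ = n

theorem ActsLikeHecke.nonempty_natReps {n : ℕ} {ξ : MatRing} (hξ : ActsLikeHecke n ξ)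
    (hpos : ∀ γ ∈ ξ.coeff.support, IsNonneg γ) : Nonempty (NatReps n ξ) := by
  have h : ∀ γ : MatPM, ∃ a b c d : ℕ, γ ∈ ξ.coeff.support →
      γ = cls a b c d ∧ (a : ℤ) * d - b * c = n := by
    intro γ
    by_cases hγ : γ ∈ ξ.coeff.support
    · obtain ⟨a, b, c, d, h⟩ := (hpos γ hγ).exists_nat (hξ.1 γ hγ)
      exact ⟨a, b, c, d, fun _ => h⟩
    · exact ⟨0, 0, 0, 0, fun h => absurd h hγ⟩
  choose a b c d h using h
  exact ⟨⟨a, b, c, d, fun γ hγ => (h γ hγ).1, fun γ hγ => (h γ hγ).2⟩⟩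

/-- The generating function form of the Hecke relation for lattice points in cones. -/
theorem ActsLikeHecke.sum_quadSum {n : ℕ} (hn : 0 < n) {ξ : MatRing} (hξ : ActsLikeHecke n ξ)
    (R : NatReps n ξ) {u v : ℝ} (hu : 0 < u) (hv : 0 < v) :
    ∑ γ ∈ ξ.coeff.support, (ξ.coeff γ : ℝ) *
        quadSum (R.a γ * u + R.b γ * v) (R.c γ * u + R.d γ * v) =
      ∑ l ∈ n.divisors, (l : ℝ) * quadSum (l * u) (l * v) := by
  have h1 := hasSum_sum (s := ξ.coeff.support) fun γ hγ =>
    (hasSum_coneWeight hn (R.det γ hγ) hu hv).mul_left (ξ.coeff γ : ℝ)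
  have h2 := hasSum_sum (s := n.divisors) fun l hl =>
    hasSum_quadrant_dvd (Nat.pos_of_mem_divisors hl) hu hv
  refine h1.unique (h2.congr_fun fun p => ?_)
  have key := hξ.sum_halfWeight_sub hn p.1 p.2
  rw [← Finset.sum_filter, ← Finset.sum_mul, ← mul_assoc, ← key, Finset.sum_mul]
  refine Finset.sum_congr rfl fun γ hγ => ?_
  rw [← mul_assoc]
  congr 2
  have := halfWeight_sub hn p.1 p.2 _ _ _ _ (R.det γ hγ)
  rwa [← R.eq_cls γ hγ, eq_comm] at this

/-! ### The digamma function -/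

open Set Filter MeasureTheory
open scoped Topology

theorem hasDerivAt_log_Gamma {y : ℝ} (hy : 0 < y) :
    HasDerivAt (Real.log ∘ Real.Gamma) (digamma y) y :=
  (Real.differentiableAt_Gamma fun m => by
    have : (0 : ℝ) ≤ m := Nat.cast_nonneg m
    linarith).hasDerivAt.log (Real.Gamma_pos_of_pos hy).ne'

theorem log_Gamma_add_one {y : ℝ} (hy : 0 < y) :
    (Real.log ∘ Real.Gamma) (y + 1) = Real.log y + (Real.log ∘ Real.Gamma) y := by
  simp only [Function.comp_apply]
  rw [Real.Gamma_add_one hy.ne', Real.log_mul hy.ne' (Real.Gamma_pos_of_pos hy).ne']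

theorem digamma_add_one {y : ℝ} (hy : 0 < y) : digamma (y + 1) = y⁻¹ + digamma y := by
  have h1 : HasDerivAt (fun z => (Real.log ∘ Real.Gamma) (z + 1)) (digamma (y + 1)) y :=
    (hasDerivAt_log_Gamma (by linarith : 0 < y + 1)).comp_add_const y 1
  have h2 := (Real.hasDerivAt_log hy.ne').add (hasDerivAt_log_Gamma hy)
  refine h1.unique (h2.congr_of_eventuallyEq ?_)
  filter_upwards [eventually_gt_nhds hy] with z hz using log_Gamma_add_one hz

theorem digamma_le_log {y : ℝ} (hy : 0 < y) : digamma y ≤ Real.log y := by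
  have h := Real.convexOn_log_Gamma.le_slope_of_hasDerivAt (mem_Ioi.2 hy)
    (mem_Ioi.2 (by linarith : 0 < y + 1)) (by linarith) (hasDerivAt_log_Gamma hy)
  rw [slope_def_field, log_Gamma_add_one hy] at h
  simpa using h

theorem log_le_digamma_add_one {y : ℝ} (hy : 0 < y) : Real.log y ≤ digamma (y + 1) := by
  have h := Real.convexOn_log_Gamma.slope_le_of_hasDerivAt (mem_Ioi.2 hy)
    (mem_Ioi.2 (by linarith : 0 < y + 1)) (by linarith) (hasDerivAt_log_Gamma (by linarith))
  rw [slope_def_field, log_Gamma_add_one hy] at h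
  simpa using h

/-- The elementary bounds `-1 / y ≤ ψ(y) - log y ≤ 0`, from the convexity of `log Γ`. -/
theorem abs_digamma_sub_log_le {y : ℝ} (hy : 0 < y) : |digamma y - Real.log y| ≤ y⁻¹ := by
  have h1 := digamma_le_log hy
  have h2 := log_le_digamma_add_one hy
  rw [digamma_add_one hy] at h2
  rw [abs_le]
  have := inv_pos.2 hy
  constructor <;> linarith

/-- Telescoping the recurrence of `ψ - log`, which tends to `0` at infinity. -/
theorem hasSum_digamma_sub_log {y : ℝ} (hy : 0 < y) :
    HasSum (fun n : ℕ => Real.log (y + n + 1) - Real.log (y + n) - (y + n)⁻¹)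
      (digamma y - Real.log y) := by
  have hpos : ∀ n : ℕ, 0 < y + n := fun n => by positivity
  suffices h : HasSum (fun n : ℕ => -(Real.log (y + n + 1) - Real.log (y + n) - (y + n)⁻¹))
      (-(digamma y - Real.log y)) by simpa only [neg_neg] using h.neg
  rw [hasSum_iff_tendsto_nat_of_nonneg]
  · have hsum : ∀ N : ℕ, ∑ n ∈ Finset.range N,
        -(Real.log (y + n + 1) - Real.log (y + n) - (y + n)⁻¹) =
        (digamma (y + N) - Real.log (y + N)) - (digamma y - Real.log y) := by
      intro N
      induction N with
      | zero => simp
      | succ N ih =>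
        rw [Finset.sum_range_succ, ih, Nat.cast_add_one, ← add_assoc, digamma_add_one (hpos N)]
        ring
    simp_rw [hsum]
    have h0 : Tendsto (fun N : ℕ => digamma (y + N) - Real.log (y + N)) atTop (𝓝 0) := by
      refine squeeze_zero_norm (fun N => abs_digamma_sub_log_le (hpos N)) ?_
      exact tendsto_inv_atTop_zero.comp
        (tendsto_atTop_add_const_left _ _ tendsto_natCast_atTop_atTop)
    simpa using h0.sub_const (digamma y - Real.log y)
  · intro n
    have hp := hpos n
    have : Real.log ((y + n + 1) / (y + n)) ≤ (y + n + 1) / (y + n) - 1 :=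
      Real.log_le_sub_one_of_pos (by positivity)
    rw [Real.log_div (by positivity) (by positivity), add_div, div_self hp.ne', one_div] at this
    linarith

theorem inv_sub_inv_add_sq {s : ℝ} (hs : 0 < s) :
    (s + 1)⁻¹ - s⁻¹ + (s ^ 2)⁻¹ = (s ^ 2 * (s + 1))⁻¹ := by
  field_simp
  ring

theorem summable_inv_add_sq {y : ℝ} (hy : 0 < y) : Summable fun n : ℕ => ((y + n) ^ 2)⁻¹ := by
  have h := (Real.summable_one_div_nat_add_rpow y 2).2 (by norm_num)
  refine h.congr fun n => ?_
  rw [abs_of_pos (by positivity), Real.rpow_two, add_comm, one_div]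

theorem hasDerivAt_digamma_sub_log {y : ℝ} (hy : 0 < y) :
    HasDerivAt (fun z => digamma z - Real.log z)
      (∑' n : ℕ, ((y + n) ^ 2 * (y + n + 1))⁻¹) y := by
  have hδ : 0 < y / 2 := by positivity
  have key : HasDerivAt
      (fun z => ∑' n : ℕ, (Real.log (z + n + 1) - Real.log (z + n) - (z + n)⁻¹))
      (∑' n : ℕ, ((y + n) ^ 2 * (y + n + 1))⁻¹) y := by
    refine hasDerivAt_tsum_of_isPreconnected (t := Ioi (y / 2))
      (g := fun (n : ℕ) (z : ℝ) => Real.log (z + n + 1) - Real.log (z + n) - (z + n)⁻¹)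
      (g' := fun (n : ℕ) (z : ℝ) => ((z + n) ^ 2 * (z + n + 1))⁻¹)
      (summable_inv_add_sq hδ) isOpen_Ioi isPreconnected_Ioi (fun n z hz => ?_) (fun n z hz => ?_) (y₀ := y) (mem_Ioi.2 (by linarith))
      (hasSum_digamma_sub_log hy).summable (mem_Ioi.2 (by linarith))
    · have hz0 : 0 < z := hδ.trans hz
      have hs : 0 < z + n := by positivity
      have d1 : HasDerivAt (fun z : ℝ => z + n) 1 z := (hasDerivAt_id z).add_const _
      have d2 : HasDerivAt (fun z : ℝ => z + n + 1) 1 z := d1.add_const _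
      have := ((d2.log (by positivity)).sub (d1.log hs.ne')).sub (d1.inv hs.ne')
      refine this.congr_deriv ?_
      rw [← inv_sub_inv_add_sq hs]
      simp only [one_div]
      ring
    · have hz' : y / 2 < z := hz
      have hz0 : 0 < z := hδ.trans hz
      rw [Real.norm_of_nonneg (by positivity)]
      gcongr
      have : (y / 2 + n) ^ 2 ≤ (z + n) ^ 2 := by gcongr
      nlinarith [show 0 ≤ (z + n) ^ 2 * (z + n) by positivity]
  refine key.congr_of_eventuallyEq ?_
  filter_upwards [eventually_gt_nhds hy] with z hz using (hasSum_digamma_sub_log hz).tsum_eq.symm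

theorem integrableOn_mul_exp_neg {s : ℝ} (hs : 0 < s) :
    IntegrableOn (fun t : ℝ => t * Real.exp (-(s * t))) (Ioi 0) := by
  have := integrableOn_rpow_mul_exp_neg_mul_rpow (p := 1) (s := 1) (b := s) (by norm_num) one_pos hs
  simpa using this

theorem integral_mul_exp_neg {s : ℝ} (hs : 0 < s) :
    ∫ t in Ioi (0 : ℝ), t * Real.exp (-(s * t)) = (s ^ 2)⁻¹ := by
  have := Real.integral_rpow_mul_exp_neg_mul_Ioi (a := 2) (r := s) (by norm_num) hs
  norm_num [Real.Gamma_two] at this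
  simpa using this

theorem integral_exp_neg {s : ℝ} (hs : 0 < s) :
    ∫ t in Ioi (0 : ℝ), Real.exp (-(s * t)) = s⁻¹ := by
  have := integral_exp_mul_Ioi (a := -s) (by linarith) 0
  simpa [neg_mul] using this

theorem integrableOn_exp_neg {s : ℝ} (hs : 0 < s) (c : ℝ) :
    IntegrableOn (fun t : ℝ => Real.exp (-(s * t))) (Ioi c) := by
  simpa only [neg_mul] using integrableOn_exp_mul_Ioi (a := -s) (by linarith) c

/-- The kernel `t / (1 - exp (-t)) - 1`, whose Laplace transform is the derivative of
`ψ - log`. -/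
noncomputable def binetKernel (t : ℝ) : ℝ := (t - 1 + Real.exp (-t)) / (1 - Real.exp (-t))

theorem one_sub_exp_neg_pos {t : ℝ} (ht : 0 < t) : 0 < 1 - Real.exp (-t) :=
  sub_pos.2 (Real.exp_lt_one_iff.2 (neg_lt_zero.2 ht))

theorem sub_one_add_exp_neg_nonneg (t : ℝ) : 0 ≤ t - 1 + Real.exp (-t) := by
  linarith [Real.add_one_le_exp (-t)]

theorem binetKernel_nonneg {t : ℝ} (ht : 0 < t) : 0 ≤ binetKernel t :=
  div_nonneg (sub_one_add_exp_neg_nonneg t) (one_sub_exp_neg_pos ht).le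

theorem binetKernel_le {t : ℝ} (ht : 0 < t) : binetKernel t ≤ t := by
  rw [binetKernel, div_le_iff₀ (one_sub_exp_neg_pos ht)]
  have h : Real.exp (-t) * (1 + t) ≤ 1 := by
    calc Real.exp (-t) * (1 + t) ≤ Real.exp (-t) * Real.exp t := by
          gcongr; linarith [Real.add_one_le_exp t]
      _ = 1 := by rw [← Real.exp_add]; simp
  linarith

theorem measurable_binetKernel : Measurable binetKernel := by
  unfold binetKernel
  fun_prop

/-- The geometric series in `exp (-t)` behind the Laplace transform of `binetKernel`. -/
theorem hasSum_binetKernel {t : ℝ} (ht : 0 < t) (y : ℝ) :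
    HasSum (fun n : ℕ => (t - 1 + Real.exp (-t)) * Real.exp (-((y + n) * t)))
      (binetKernel t * Real.exp (-(y * t))) := by
  have h := ((hasSum_exp_neg_mul ht).mul_left (t - 1 + Real.exp (-t))).mul_right
    (Real.exp (-(y * t)))
  rw [binetKernel, div_eq_mul_inv]
  refine h.congr_fun fun n => ?_
  rw [mul_assoc, ← Real.exp_add]
  congr 2
  ring

theorem integrableOn_binetKernel_mul_exp {y : ℝ} (hy : 0 < y) :
    IntegrableOn (fun t => binetKernel t * Real.exp (-(y * t))) (Ioi 0) := by
  refine (integrableOn_mul_exp_neg hy).mono'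
    (by have := measurable_binetKernel; fun_prop) ?_
  filter_upwards [ae_restrict_mem measurableSet_Ioi] with t ht
  rw [Real.norm_of_nonneg (mul_nonneg (binetKernel_nonneg ht) (Real.exp_pos _).le)]
  gcongr
  exact binetKernel_le ht

/-- The derivative of `ψ - log` as a Laplace transform. -/
theorem tsum_eq_integral_binetKernel {y : ℝ} (hy : 0 < y) :
    ∑' n : ℕ, ((y + n) ^ 2 * (y + n + 1))⁻¹ =
      ∫ t in Ioi (0 : ℝ), binetKernel t * Real.exp (-(y * t)) := by
  have hpos : ∀ n : ℕ, 0 < y + n := fun n => by positivity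
  have hsplit : ∀ s t : ℝ, (t - 1 + Real.exp (-t)) * Real.exp (-(s * t)) =
      t * Real.exp (-(s * t)) - Real.exp (-(s * t)) + Real.exp (-((s + 1) * t)) := by
    intro s t
    rw [show -((s + 1) * t) = -t + -(s * t) by ring, Real.exp_add]
    ring
  have hint : ∀ s : ℝ, 0 < s →
      IntegrableOn (fun t => (t - 1 + Real.exp (-t)) * Real.exp (-(s * t))) (Ioi 0) := by
    intro s hs
    simp_rw [hsplit]
    exact ((integrableOn_mul_exp_neg hs).sub (integrableOn_exp_neg hs 0)).add
      (integrableOn_exp_neg (by linarith) 0)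
  have hval : ∀ s : ℝ, 0 < s →
      ∫ t in Ioi (0 : ℝ), (t - 1 + Real.exp (-t)) * Real.exp (-(s * t)) = (s ^ 2 * (s + 1))⁻¹ := by
    intro s hs
    simp_rw [hsplit]
    have h2 := (integrableOn_mul_exp_neg hs).sub (integrableOn_exp_neg hs 0)
    have h3 := integrableOn_exp_neg (by linarith : 0 < s + 1) 0
    rw [show (∫ t in Ioi (0 : ℝ), (t * Real.exp (-(s * t)) - Real.exp (-(s * t)) +
        Real.exp (-((s + 1) * t)))) = _ from integral_add h2 h3,
      integral_sub (integrableOn_mul_exp_neg hs)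
      (integrableOn_exp_neg hs 0), integral_mul_exp_neg hs, integral_exp_neg hs,
      integral_exp_neg (by linarith), ← inv_sub_inv_add_sq hs]
    ring
  have hnorm : ∀ n : ℕ, ∫ t in Ioi (0 : ℝ),
      ‖(t - 1 + Real.exp (-t)) * Real.exp (-((y + n) * t))‖ =
      ((y + n) ^ 2 * (y + n + 1))⁻¹ := by
    intro n
    rw [← hval _ (hpos n)]
    refine integral_congr_ae (Eventually.of_forall fun t => ?_)
    exact Real.norm_of_nonneg (mul_nonneg (sub_one_add_exp_neg_nonneg t) (Real.exp_pos _).le)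
  have hsum : Summable fun n : ℕ => ((y + n) ^ 2 * (y + n + 1))⁻¹ := by
    refine Summable.of_nonneg_of_le (fun n => by have := hpos n; positivity) (fun n => ?_)
      (summable_inv_add_sq hy)
    have := hpos n
    gcongr
    nlinarith [show 0 < (y + n) ^ 2 * (y + n) by positivity]
  have h := hasSum_integral_of_summable_integral_norm (fun n : ℕ => hint _ (hpos n))
    (hsum.congr fun n => (hnorm n).symm)
  simp_rw [hval _ (hpos _)] at h
  rw [h.tsum_eq]
  exact setIntegral_congr_fun measurableSet_Ioi fun t ht => (hasSum_binetKernel ht y).tsum_eq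

theorem integral_binetKernel_le {y : ℝ} (hy : 0 < y) :
    ∫ t in Ioi (0 : ℝ), binetKernel t * Real.exp (-(y * t)) ≤ (y ^ 2)⁻¹ := by
  rw [← integral_mul_exp_neg hy]
  refine setIntegral_mono_on (integrableOn_binetKernel_mul_exp hy) (integrableOn_mul_exp_neg hy)
    measurableSet_Ioi fun t ht => ?_
  gcongr
  exact binetKernel_le ht

theorem integral_binetKernel_nonneg (y : ℝ) :
    0 ≤ ∫ t in Ioi (0 : ℝ), binetKernel t * Real.exp (-(y * t)) :=
  setIntegral_nonneg measurableSet_Ioi fun _ ht =>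
    mul_nonneg (binetKernel_nonneg ht) (Real.exp_pos _).le

/-! ### The derivative of the Herglotz function and the finite part of the lattice sum -/

theorem exp_sub_one_pos {s : ℝ} (hs : 0 < s) : 0 < Real.exp s - 1 :=
  sub_pos.2 (Real.one_lt_exp_iff.2 hs)

theorem hasSum_exp_neg_add_one_mul {s : ℝ} (hs : 0 < s) :
    HasSum (fun m : ℕ => Real.exp (-((m + 1) * s))) (Real.exp s - 1)⁻¹ := by
  have h := (hasSum_exp_neg_mul hs).mul_left (Real.exp (-s))
  have hv : (Real.exp s - 1)⁻¹ = Real.exp (-s) * (1 - Real.exp (-s))⁻¹ := by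
    have h1 := (exp_sub_one_pos hs).ne'
    have h2 := (one_sub_exp_neg_pos hs).ne'
    field_simp
    rw [sub_mul, ← Real.exp_add]
    simp
  rw [hv]
  refine h.congr_fun fun m => ?_
  rw [← Real.exp_add]
  congr 1
  ring

theorem div_exp_sub_one_le {x t : ℝ} (hx : 0 < x) (ht : 0 < t) :
    t / (Real.exp (x * t) - 1) ≤ x⁻¹ * Real.exp (-(x / 2 * t)) := by
  have hxt : 0 < x * t := mul_pos hx ht
  rw [div_le_iff₀ (exp_sub_one_pos hxt)]
  -- `exp s - 1 = 2 exp (s / 2) sinh (s / 2) ≥ s exp (s / 2)` for `s = x t`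
  have h : x * t / 2 ≤ Real.sinh (x * t / 2) := Real.self_le_sinh_iff.2 (by positivity)
  rw [Real.sinh_eq] at h
  have h3 : Real.exp (-(x / 2 * t)) * (Real.exp (x * t) - 1) =
      Real.exp (x * t / 2) - Real.exp (-(x * t / 2)) := by
    rw [mul_sub, ← Real.exp_add, mul_one]
    congr 2 <;> ring
  rw [mul_assoc, h3]
  calc t = x⁻¹ * (x * t) := by field_simp
    _ ≤ _ := by gcongr; linarith

/-- Functions dominated by `t` are integrable against `1 / (exp (x t) - 1)` on `(0, ∞)`. -/
theorem integrableOn_div_exp_sub_one {g : ℝ → ℝ} (hg : Measurable g) (h0 : ∀ t, 0 < t → 0 ≤ g t)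
    (hle : ∀ t, 0 < t → g t ≤ t) {x : ℝ} (hx : 0 < x) :
    IntegrableOn (fun t => g t / (Real.exp (x * t) - 1)) (Ioi 0) := by
  refine ((integrableOn_exp_neg (half_pos hx) 0).const_mul x⁻¹).mono'
    (by fun_prop : Measurable fun t => g t / (Real.exp (x * t) - 1)).aestronglyMeasurable ?_
  filter_upwards [ae_restrict_mem measurableSet_Ioi] with t ht
  have ht : 0 < t := ht
  have hp := exp_sub_one_pos (mul_pos hx ht)
  rw [Real.norm_of_nonneg (div_nonneg (h0 t ht) hp.le)]
  refine le_trans ?_ (div_exp_sub_one_le hx ht)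
  gcongr
  exact hle t ht

theorem hasSum_integral_div_exp_sub_one {g : ℝ → ℝ} (hg : Measurable g)
    (h0 : ∀ t, 0 < t → 0 ≤ g t) (hle : ∀ t, 0 < t → g t ≤ t) {x : ℝ} (hx : 0 < x) :
    HasSum (fun m : ℕ => ∫ t in Ioi (0 : ℝ), g t * Real.exp (-((m + 1) * x * t)))
      (∫ t in Ioi (0 : ℝ), g t / (Real.exp (x * t) - 1)) := by
  have hpos : ∀ m : ℕ, 0 < ((m : ℝ) + 1) * x := fun m => by positivity
  have hint : ∀ m : ℕ, IntegrableOn (fun t => g t * Real.exp (-((m + 1) * x * t))) (Ioi 0) := by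
    intro m
    refine (integrableOn_mul_exp_neg (hpos m)).mono' (by fun_prop) ?_
    filter_upwards [ae_restrict_mem measurableSet_Ioi] with t ht
    rw [Real.norm_of_nonneg (mul_nonneg (h0 t ht) (Real.exp_pos _).le)]
    gcongr
    exact hle t ht
  have hsum : Summable fun m : ℕ => ((((m : ℝ) + 1) * x) ^ 2)⁻¹ := by
    refine ((summable_inv_add_sq one_pos).mul_right (x ^ 2)⁻¹).congr fun m => ?_
    rw [mul_pow, mul_inv, add_comm]
  have hnorm : ∀ m : ℕ, ∫ t in Ioi (0 : ℝ), ‖g t * Real.exp (-((m + 1) * x * t))‖ ≤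
      ((((m : ℝ) + 1) * x) ^ 2)⁻¹ := by
    intro m
    rw [← integral_mul_exp_neg (hpos m)]
    refine setIntegral_mono_on (hint m).norm (integrableOn_mul_exp_neg (hpos m)) measurableSet_Ioi
      fun t ht => ?_
    rw [Real.norm_of_nonneg (mul_nonneg (h0 t ht) (Real.exp_pos _).le)]
    gcongr
    exact hle t ht
  have hs : Summable fun m : ℕ => ∫ t in Ioi (0 : ℝ), ‖g t * Real.exp (-((m + 1) * x * t))‖ :=
    Summable.of_nonneg_of_le (fun m => integral_nonneg fun t => norm_nonneg _) hnorm hsum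
  have h := hasSum_integral_of_summable_integral_norm hint hs
  have heq : ∫ t in Ioi (0 : ℝ), g t / (Real.exp (x * t) - 1) =
      ∫ t in Ioi (0 : ℝ), ∑' m : ℕ, g t * Real.exp (-((m + 1) * x * t)) := by
    refine setIntegral_congr_fun measurableSet_Ioi fun t ht => ?_
    have := (hasSum_exp_neg_add_one_mul (mul_pos hx ht)).mul_left (g t)
    simp only [← mul_assoc] at this
    exact this.tsum_eq.symm
  rwa [heq]

theorem integral_id_div_exp_sub_one {x : ℝ} (hx : 0 < x) :
    ∫ t in Ioi (0 : ℝ), t / (Real.exp (x * t) - 1) = Real.pi ^ 2 / 6 * (x ^ 2)⁻¹ := by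
  have h := hasSum_integral_div_exp_sub_one (g := fun t => t) measurable_id (fun t ht => ht.le)
    (fun t _ => le_rfl) hx
  have hz : HasSum (fun m : ℕ => (1 : ℝ) / ((m + 1 : ℕ) : ℝ) ^ 2) (Real.pi ^ 2 / 6) := by
    simpa using (hasSum_nat_add_iff' 1).2 hasSum_zeta_two
  refine h.unique ((hz.mul_right (x ^ 2)⁻¹).congr_fun fun m => ?_)
  rw [integral_mul_exp_neg (by positivity), mul_pow, mul_inv]
  push_cast
  rw [one_div]

/-- The derivative of the Herglotz function, as an integral. -/
noncomputable def herglotzDeriv (x : ℝ) : ℝ :=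
  ∫ t in Ioi (0 : ℝ), binetKernel t / (Real.exp (x * t) - 1)

theorem hasDerivAt_herglotzF {x : ℝ} (hx : 0 < x) : HasDerivAt herglotzF (herglotzDeriv x) x := by
  have hδ : 0 < x / 2 := by positivity
  have hF' := hasSum_integral_div_exp_sub_one measurable_binetKernel
    (fun _ ht => binetKernel_nonneg ht) (fun _ ht => binetKernel_le ht) hx
  rw [herglotzDeriv, ← hF'.tsum_eq]
  have hu : Summable fun m : ℕ => (((1 : ℝ) + m) ^ 2)⁻¹ * ((x / 2) ^ 2)⁻¹ :=
    (summable_inv_add_sq one_pos).mul_right _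
  refine hasDerivAt_tsum_of_isPreconnected (t := Ioi (x / 2)) (y₀ := x)
    (g := fun (m : ℕ) (z : ℝ) => (digamma (((m : ℝ) + 1) * z) - Real.log (((m : ℝ) + 1) * z)) /
      ((m : ℝ) + 1))
    (g' := fun (m : ℕ) (z : ℝ) =>
      ∫ t in Ioi (0 : ℝ), binetKernel t * Real.exp (-((m + 1) * z * t)))
    hu isOpen_Ioi isPreconnected_Ioi (fun m z hz => ?_) (fun m z hz => ?_)
    (mem_Ioi.2 (by linarith)) ?_ (mem_Ioi.2 (by linarith))
  · have hz0 : 0 < z := hδ.trans hz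
    have hm : (0 : ℝ) < m + 1 := by positivity
    have h1 : HasDerivAt (fun z : ℝ => ((m : ℝ) + 1) * z) ((m : ℝ) + 1) z := by
      simpa using (hasDerivAt_id z).const_mul ((m : ℝ) + 1)
    have h2 := (hasDerivAt_digamma_sub_log (mul_pos hm hz0)).comp z h1
    refine (h2.div_const ((m : ℝ) + 1)).congr_deriv ?_
    rw [tsum_eq_integral_binetKernel (mul_pos hm hz0)]
    field_simp
  · have hz0 : 0 < z := hδ.trans hz
    have hz' : x / 2 < z := hz
    rw [Real.norm_of_nonneg (integral_binetKernel_nonneg _)]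
    refine (integral_binetKernel_le (by positivity)).trans ?_
    rw [mul_pow, mul_inv, add_comm (m : ℝ) 1]
    gcongr
  · refine Summable.of_norm_bounded ((summable_inv_add_sq one_pos).mul_right x⁻¹) fun m => ?_
    have hm : (0 : ℝ) < m + 1 := by positivity
    rw [norm_div, Real.norm_of_nonneg hm.le, div_le_iff₀ hm]
    refine (abs_digamma_sub_log_le (mul_pos hm hx)).trans (le_of_eq ?_)
    rw [add_comm (1 : ℝ) m]
    field_simp

/-- The derivative of the modified Herglotz function. -/
noncomputable def modHerglotzDeriv (x : ℝ) : ℝ :=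
  herglotzDeriv x + Real.pi ^ 2 / 12 * (1 - (x ^ 2)⁻¹) - Real.log x / (2 * x)

theorem hasDerivAt_modHerglotz {x : ℝ} (hx : 0 < x) :
    HasDerivAt modHerglotz (modHerglotzDeriv x) x := by
  have h1 := (hasDerivAt_herglotzF hx).sub_const (herglotzF 1)
  have h2 := (((hasDerivAt_id x).sub_const 2).add (hasDerivAt_inv hx.ne')).const_mul
    (Real.pi ^ 2 / 12)
  have h3 := ((Real.hasDerivAt_log hx.ne').pow 2).div_const 4
  refine ((h1.add h2).sub h3).congr_deriv ?_
  unfold modHerglotzDeriv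
  field_simp
  ring

/-- The lattice sum at `(t u, t v)`, multiplied by `t`, split into parts that are integrable on
`(0, ∞)` and the explicit singular part `2 / (v (exp (t u) - 1))`. -/
theorem mul_quadSum_eq {u v t : ℝ} (hu : 0 < u) (hv : 0 < v) (ht : 0 < t) :
    t * quadSum (t * u) (t * v) =
      2 / v * (binetKernel (v * t) / (Real.exp (u * t) - 1)) +
        (t / (Real.exp (v * t) - 1) - t / (Real.exp (u * t) - 1)) +
        2 / v * (Real.exp (u * t) - 1)⁻¹ := by
  have hU := (exp_sub_one_pos (mul_pos hu ht)).ne'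
  have hV := (exp_sub_one_pos (mul_pos hv ht)).ne'
  have h1 : 1 - (Real.exp (u * t))⁻¹ ≠ 0 := by
    rw [← Real.exp_neg]; exact (one_sub_exp_neg_pos (mul_pos hu ht)).ne'
  have h2 : 1 - (Real.exp (v * t))⁻¹ ≠ 0 := by
    rw [← Real.exp_neg]; exact (one_sub_exp_neg_pos (mul_pos hv ht)).ne'
  unfold quadSum binetKernel
  rw [mul_comm t u, mul_comm t v, Real.exp_neg, Real.exp_neg]
  have hA := (Real.exp_pos (u * t)).ne'
  have hB := (Real.exp_pos (v * t)).ne'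
  generalize Real.exp (u * t) = A at *
  generalize Real.exp (v * t) = B at *
  have e1 : 1 - A⁻¹ = (A - 1) / A := by field_simp
  have e2 : 1 - B⁻¹ = (B - 1) / B := by field_simp
  rw [e1, e2]
  field_simp
  ring

theorem integrableOn_inv_exp_sub_one {u ε : ℝ} (hu : 0 < u) (hε : 0 < ε) :
    IntegrableOn (fun t => (Real.exp (u * t) - 1)⁻¹) (Ioi ε) ∧
      ∫ t in Ioi ε, (Real.exp (u * t) - 1)⁻¹ = -(Real.log (1 - Real.exp (-(u * ε))) / u) := by
  have hder : ∀ t ∈ Ici ε, HasDerivAt (fun t => Real.log (1 - Real.exp (-(u * t))) / u)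
      ((Real.exp (u * t) - 1)⁻¹) t := by
    intro t ht
    have ht0 : 0 < t := hε.trans_le ht
    have hp := one_sub_exp_neg_pos (mul_pos hu ht0)
    have h1 : HasDerivAt (fun t : ℝ => -(u * t)) (-u) t :=
      ((hasDerivAt_id t).const_mul u).neg.congr_deriv (by simp)
    refine (((h1.exp.const_sub 1).log hp.ne').div_const u).congr_deriv ?_
    have hq := (exp_sub_one_pos (mul_pos hu ht0)).ne'
    have hA := (Real.exp_pos (u * t)).ne'
    rw [Real.exp_neg] at hp ⊢
    have e1 : 1 - (Real.exp (u * t))⁻¹ = (Real.exp (u * t) - 1) / Real.exp (u * t) := by field_simp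
    rw [e1]
    field_simp
  have hlim : Tendsto (fun t => Real.log (1 - Real.exp (-(u * t))) / u) atTop (𝓝 0) := by
    have h1 : Tendsto (fun t : ℝ => Real.exp (-(u * t))) atTop (𝓝 0) :=
      Real.tendsto_exp_neg_atTop_nhds_zero.comp (tendsto_id.const_mul_atTop hu)
    have h2 : Tendsto (fun t : ℝ => 1 - Real.exp (-(u * t))) atTop (𝓝 1) := by
      simpa using h1.const_sub 1
    have h3 := (h2.log one_ne_zero).div_const u
    simpa using h3
  have hnn : ∀ t ∈ Ioi ε, 0 ≤ (Real.exp (u * t) - 1)⁻¹ := fun t ht =>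
    inv_nonneg.2 (exp_sub_one_pos (mul_pos hu (hε.trans ht))).le
  refine ⟨integrableOn_Ioi_deriv_of_nonneg' hder hnn hlim, ?_⟩
  rw [integral_Ioi_of_hasDerivAt_of_nonneg' hder hnn hlim, zero_sub]

theorem tendsto_log_one_sub_exp {u : ℝ} (hu : 0 < u) :
    Tendsto (fun ε : ℝ => Real.log ε - Real.log (1 - Real.exp (-(u * ε)))) (𝓝[>] 0)
      (𝓝 (-Real.log u)) := by
  have h0 : HasDerivAt (fun ε : ℝ => 1 - Real.exp (-(u * ε))) u 0 := by
    have h1 : HasDerivAt (fun t : ℝ => -(u * t)) (-u) 0 :=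
      ((hasDerivAt_id (0 : ℝ)).const_mul u).neg.congr_deriv (by simp)
    simpa using h1.exp.const_sub 1
  have h2 : Tendsto (fun ε : ℝ => ε⁻¹ * (1 - Real.exp (-(u * ε)))) (𝓝[>] 0) (𝓝 u) := by
    have := h0.tendsto_slope_zero_right
    simpa using this
  refine ((h2.log hu.ne').neg).congr' ?_
  filter_upwards [self_mem_nhdsWithin] with ε hε
  have hε : 0 < ε := hε
  rw [Real.log_mul (inv_ne_zero hε.ne') (one_sub_exp_neg_pos (mul_pos hu hε)).ne', Real.log_inv]
  ring

/-- The part of `t` times the lattice sum at `(t u, t v)` that is integrable on `(0, ∞)`. -/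
noncomputable def regularPart (u v t : ℝ) : ℝ :=
  2 / v * (binetKernel (v * t) / (Real.exp (u * t) - 1)) +
    (t / (Real.exp (v * t) - 1) - t / (Real.exp (u * t) - 1))

theorem integrableOn_binetKernel_comp_div {u v : ℝ} (hu : 0 < u) (hv : 0 < v) :
    IntegrableOn (fun t => binetKernel (v * t) / (Real.exp (u * t) - 1)) (Ioi 0) := by
  have hm : Measurable fun t => v⁻¹ * binetKernel (v * t) := by
    have := measurable_binetKernel
    fun_prop
  have h := (integrableOn_div_exp_sub_one hm
    (fun t ht => mul_nonneg (inv_pos.2 hv).le (binetKernel_nonneg (mul_pos hv ht)))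
    (fun t ht => (inv_mul_le_iff₀ hv).2 (binetKernel_le (mul_pos hv ht))) hu).const_mul v
  refine h.congr (Eventually.of_forall fun t => ?_)
  dsimp only
  rw [mul_div_assoc, ← mul_assoc, mul_inv_cancel₀ hv.ne', one_mul]

theorem integrableOn_id_div_exp_sub_one {x : ℝ} (hx : 0 < x) :
    IntegrableOn (fun t => t / (Real.exp (x * t) - 1)) (Ioi 0) :=
  integrableOn_div_exp_sub_one measurable_id (fun _ ht => ht.le) (fun _ _ => le_rfl) hx

theorem integrableOn_regularPart {u v : ℝ} (hu : 0 < u) (hv : 0 < v) :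
    IntegrableOn (regularPart u v) (Ioi 0) :=
  ((integrableOn_binetKernel_comp_div hu hv).const_mul _).add
    ((integrableOn_id_div_exp_sub_one hv).sub (integrableOn_id_div_exp_sub_one hu))

theorem integral_regularPart {u v : ℝ} (hu : 0 < u) (hv : 0 < v) :
    ∫ t in Ioi (0 : ℝ), regularPart u v t =
      2 * (v ^ 2)⁻¹ * herglotzDeriv (u / v) + Real.pi ^ 2 / 6 * ((v ^ 2)⁻¹ - (u ^ 2)⁻¹) := by
  have h1 : ∫ t in Ioi (0 : ℝ), binetKernel (v * t) / (Real.exp (u * t) - 1) =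
      v⁻¹ * herglotzDeriv (u / v) := by
    have h := integral_comp_mul_left_Ioi
      (fun s => binetKernel s / (Real.exp (u / v * s) - 1)) 0 hv
    rw [mul_zero, smul_eq_mul] at h
    rw [herglotzDeriv, ← h]
    refine integral_congr_ae (Eventually.of_forall fun t => ?_)
    dsimp only
    rw [← mul_assoc, div_mul_cancel₀ u hv.ne']
  have i1 := (integrableOn_binetKernel_comp_div hu hv).const_mul (2 / v)
  have i2 := integrableOn_id_div_exp_sub_one hv
  have i3 := integrableOn_id_div_exp_sub_one hu
  rw [show ∫ t in Ioi (0 : ℝ), regularPart u v t = _ from integral_add i1 (i2.sub i3),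
    show ∫ t in Ioi (0 : ℝ), _ = _ from integral_sub i2 i3, integral_const_mul, h1,
    integral_id_div_exp_sub_one hu, integral_id_div_exp_sub_one hv]
  field_simp

theorem integrableOn_mul_quadSum {u v ε : ℝ} (hu : 0 < u) (hv : 0 < v) (hε : 0 < ε) :
    IntegrableOn (fun t => t * quadSum (t * u) (t * v)) (Ioi ε) := by
  have h := ((integrableOn_regularPart hu hv).mono_set (Ioi_subset_Ioi hε.le)).add
    ((integrableOn_inv_exp_sub_one hu hε).1.const_mul (2 / v))
  refine h.congr_fun (fun t ht => ?_) measurableSet_Ioi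
  exact (mul_quadSum_eq hu hv (hε.trans ht)).symm

/-- The logarithmically divergent integral of `t` times the lattice sum at `(t u, t v)`: its
finite part is given by the derivative of the modified Herglotz function at `u / v`. -/
theorem tendsto_integral_mul_quadSum {u v : ℝ} (hu : 0 < u) (hv : 0 < v) :
    Tendsto (fun ε => (∫ t in Ioi ε, t * quadSum (t * u) (t * v)) + 2 * Real.log ε / (u * v))
      (𝓝[>] 0) (𝓝 (2 * (v ^ 2)⁻¹ * modHerglotzDeriv (u / v) - Real.log (u * v) / (u * v))) := by
  have h1 : Tendsto (fun ε => ∫ t in Ioi ε, regularPart u v t) (𝓝[>] 0)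
      (𝓝 (∫ t in Ioi (0 : ℝ), regularPart u v t)) := by
    have hc : AECover (volume.restrict (Ioi (0 : ℝ))) (𝓝[>] 0) fun ε : ℝ => Ioi ε :=
      aecover_Ioi_of_Ioi (tendsto_id.mono_left nhdsWithin_le_nhds)
    refine (hc.integral_tendsto_of_countably_generated (integrableOn_regularPart hu hv)).congr' ?_
    filter_upwards [self_mem_nhdsWithin] with ε hε
    rw [Measure.restrict_restrict measurableSet_Ioi,
      inter_eq_left.2 (Ioi_subset_Ioi (le_of_lt hε))]
  have h2 := h1.add ((tendsto_log_one_sub_exp hu).const_mul (2 / (u * v)))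
  rw [integral_regularPart hu hv] at h2
  have hval : 2 * (v ^ 2)⁻¹ * modHerglotzDeriv (u / v) - Real.log (u * v) / (u * v) =
      2 * (v ^ 2)⁻¹ * herglotzDeriv (u / v) + Real.pi ^ 2 / 6 * ((v ^ 2)⁻¹ - (u ^ 2)⁻¹) +
        2 / (u * v) * -Real.log u := by
    unfold modHerglotzDeriv
    rw [Real.log_mul hu.ne' hv.ne', Real.log_div hu.ne' hv.ne']
    field_simp
    ring
  rw [hval]
  refine h2.congr' ?_
  filter_upwards [self_mem_nhdsWithin] with ε hε
  have hε : 0 < ε := hε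
  obtain ⟨i1, e1⟩ := integrableOn_inv_exp_sub_one hu hε
  have i2 := (integrableOn_regularPart hu hv).mono_set (Ioi_subset_Ioi hε.le)
  have h3 : ∫ t in Ioi ε, t * quadSum (t * u) (t * v) =
      (∫ t in Ioi ε, regularPart u v t) + 2 / v * ∫ t in Ioi ε, (Real.exp (u * t) - 1)⁻¹ := by
    rw [← integral_const_mul, ← integral_add i2 (i1.const_mul _)]
    exact setIntegral_congr_fun measurableSet_Ioi fun t ht => mul_quadSum_eq hu hv (hε.trans ht)
  rw [h3, e1]
  field_simp
  ring

/-! ### The Rogers dilogarithm -/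

theorem hasDerivAt_dilog {t : ℝ} (h0 : 0 < t) (h1 : t < 1) :
    HasDerivAt dilog (-Real.log (1 - t) / t) t := by
  obtain ⟨r, htr, hr1⟩ := exists_between h1
  have hr0 : 0 < r := h0.trans htr
  have key : HasDerivAt (fun z : ℝ => ∑' m : ℕ, z ^ (m + 1) / ((m : ℝ) + 1) ^ 2)
      (∑' m : ℕ, t ^ m / ((m : ℝ) + 1)) t := by
    refine hasDerivAt_tsum_of_isPreconnected (t := Ioo 0 r)
      (g := fun (m : ℕ) (z : ℝ) => z ^ (m + 1) / ((m : ℝ) + 1) ^ 2)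
      (g' := fun (m : ℕ) (z : ℝ) => z ^ m / ((m : ℝ) + 1)) (y₀ := t)
      (summable_geometric_of_lt_one hr0.le hr1) isOpen_Ioo isPreconnected_Ioo
      (fun m z _ => ?_) (fun m z hz => ?_) ⟨h0, htr⟩ ?_ ⟨h0, htr⟩
    · refine ((hasDerivAt_pow (m + 1) z).div_const (((m : ℝ) + 1) ^ 2)).congr_deriv ?_
      simp only [Nat.add_sub_cancel, Nat.cast_add, Nat.cast_one]
      field_simp
    · have hz0 : 0 < z := hz.1
      rw [Real.norm_of_nonneg (by positivity)]
      refine (div_le_self (by positivity) (by linarith [Nat.cast_nonneg (α := ℝ) m])).trans ?_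
      exact pow_le_pow_left₀ hz0.le hz.2.le m
    · refine Summable.of_nonneg_of_le (fun m => by positivity) (fun m => ?_)
        (summable_geometric_of_lt_one h0.le h1)
      refine (div_le_self (by positivity) ?_).trans
        (pow_le_pow_of_le_one h0.le h1.le (Nat.le_succ m))
      exact one_le_pow₀ (by linarith [Nat.cast_nonneg (α := ℝ) m])
  refine key.congr_deriv ?_
  have hlog := (Real.hasSum_pow_div_log_of_abs_lt_one (by rwa [abs_of_pos h0])).div_const t
  rw [← hlog.tsum_eq]
  refine tsum_congr fun m => ?_
  field_simp
  ring

/-- The derivative of the Rogers dilogarithm on `(0, 1)`. -/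
theorem hasDerivAt_rogersL {t : ℝ} (h0 : 0 < t) (h1 : t < 1) :
    HasDerivAt rogersL (-(Real.log (1 - t) / t + Real.log t / (1 - t)) / 2) t := by
  have h1' : 0 < 1 - t := sub_pos.2 h1
  have hl : HasDerivAt (fun z : ℝ => 1 / 2 * Real.log z) (1 / 2 * t⁻¹) t :=
    (Real.hasDerivAt_log h0.ne').const_mul _
  have hr : HasDerivAt (fun z : ℝ => Real.log (1 - z)) (-1 / (1 - t)) t :=
    ((hasDerivAt_id t).const_sub 1).log h1'.ne'
  have key : HasDerivAt rogersUnit (-(Real.log (1 - t) / t + Real.log t / (1 - t)) / 2) t := by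
    refine ((hasDerivAt_dilog h0 h1).add (hl.mul hr)).congr_deriv ?_
    field_simp
    ring
  refine key.congr_of_eventuallyEq ?_
  filter_upwards [eventually_gt_nhds h0, eventually_lt_nhds h1] with z hz0 hz1
  rw [rogersL, if_neg hz1.not_gt, if_neg hz0.not_gt]

/-! ### The Hecke relation for derivatives -/

section Representatives

variable {n : ℕ} {ξ : MatRing}

/-- Functions of the bottom row: the sum of their differences between the two rows. -/
theorem ActsLikeHecke.sum_rows (hξ : ActsLikeHecke n ξ) (R : NatReps n ξ) (φ : ℤ → ℤ → ℝ)
    (hφ : ∀ c d, φ (-c) (-d) = φ c d) :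
    ∑ γ ∈ ξ.coeff.support, (ξ.coeff γ : ℝ) * (φ (R.c γ) (R.d γ) - φ (R.a γ) (R.b γ)) =
      ∑ l ∈ n.divisors, (l : ℝ) * (φ 0 l - φ l 0) := by
  have h := hξ.sum_sub (fun _ _ c d => φ c d) (fun _ _ c d => hφ c d) (fun _ _ _ _ => rfl)
  have hl : ∀ γ ∈ ξ.coeff.support, (ξ.coeff γ : ℝ) * (φ (R.c γ) (R.d γ) - φ (R.a γ) (R.b γ)) =
      (ξ.coeff γ : ℝ) * (entryFun (fun _ _ c d => φ c d) (fun _ _ c d => hφ c d) γ -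
        entryFun (fun _ _ c d => φ c d) (fun _ _ c d => hφ c d) (cls 0 (-1) 1 0 * γ)) := by
    intro γ hγ
    conv_rhs => rw [R.eq_cls γ hγ, cls_mul, entryFun_cls, entryFun_cls, ← R.eq_cls γ hγ]
    simp
  rw [Finset.sum_congr rfl hl, h]
  simp only [Finset.sum_const, Finset.card_range, nsmul_eq_mul]
  exact Nat.sum_divisorsAntidiagonal' (f := fun _ l => (l : ℝ) * (φ 0 l - φ l 0))

theorem sigma_one_eq_sum (n : ℕ) :
    (ArithmeticFunction.sigma 1 n : ℝ) = ∑ l ∈ n.divisors, (l : ℝ) := by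
  rw [ArithmeticFunction.sigma_one_apply, Nat.cast_sum]

namespace NatReps

variable (R : NatReps n ξ) {γ : MatPM} {x : ℝ}

/-- The numerator of `γ(x)`. -/
def num (γ : MatPM) (x : ℝ) : ℝ := R.a γ * x + R.b γ

/-- The denominator of `γ(x)`. -/
def den (γ : MatPM) (x : ℝ) : ℝ := R.c γ * x + R.d γ

variable {R}

theorem det_real (hγ : γ ∈ ξ.coeff.support) :
    (R.a γ : ℝ) * R.d γ - R.b γ * R.c γ = n := by
  exact_mod_cast R.det γ hγ

theorem a_mul_d_pos (hn : 0 < n) (hγ : γ ∈ ξ.coeff.support) : (0 : ℝ) < R.a γ * R.d γ := by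
  have h := R.det_real hγ
  have h0 : (0 : ℝ) < n := by exact_mod_cast hn
  have : (0 : ℝ) ≤ R.b γ * R.c γ := by positivity
  linarith

theorem a_pos (hn : 0 < n) (hγ : γ ∈ ξ.coeff.support) : (0 : ℝ) < R.a γ :=
  pos_of_mul_pos_left (R.a_mul_d_pos hn hγ) (Nat.cast_nonneg _)

theorem d_pos (hn : 0 < n) (hγ : γ ∈ ξ.coeff.support) : (0 : ℝ) < R.d γ :=
  pos_of_mul_pos_right (R.a_mul_d_pos hn hγ) (Nat.cast_nonneg _)

theorem num_pos (hn : 0 < n) (hγ : γ ∈ ξ.coeff.support) (hx : 0 < x) : 0 < R.num γ x := by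
  have := R.a_pos hn hγ
  unfold num
  positivity

theorem den_pos (hn : 0 < n) (hγ : γ ∈ ξ.coeff.support) (hx : 0 < x) : 0 < R.den γ x := by
  have := R.d_pos hn hγ
  unfold den
  positivity

theorem moebius_eq (hγ : γ ∈ ξ.coeff.support) (x : ℝ) :
    moebius γ x = R.num γ x / R.den γ x := by
  conv_lhs => rw [R.eq_cls γ hγ, moebius_cls]
  simp [num, den]

theorem imageInfty_eq_infty_iff (hγ : γ ∈ ξ.coeff.support) :
    imageInfty γ = OnePoint.infty ↔ R.c γ = 0 := by
  conv_lhs => rw [R.eq_cls γ hγ, imageInfty_cls]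
  split_ifs with h
  · simpa using h
  · simpa using h

theorem imageInftyReal_eq (hγ : γ ∈ ξ.coeff.support) (hc : R.c γ ≠ 0) :
    imageInftyReal γ = R.a γ / R.c γ := by
  unfold imageInftyReal
  conv_lhs => rw [R.eq_cls γ hγ, imageInfty_cls, if_neg (by exact_mod_cast hc)]
  simp

theorem hasDerivAt_moebius (hn : 0 < n) (hγ : γ ∈ ξ.coeff.support) (hx : 0 < x) :
    HasDerivAt (moebius γ) (n / R.den γ x ^ 2) x := by
  have hV := (R.den_pos hn hγ hx).ne'
  have h1 : HasDerivAt (R.num γ) (R.a γ) x :=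
    (((hasDerivAt_id x).const_mul (R.a γ : ℝ)).add_const (R.b γ : ℝ)).congr_deriv (mul_one _)
  have h2 : HasDerivAt (R.den γ) (R.c γ) x :=
    (((hasDerivAt_id x).const_mul (R.c γ : ℝ)).add_const (R.d γ : ℝ)).congr_deriv (mul_one _)
  have h3 := (h1.div h2 hV).congr_deriv (g' := n / R.den γ x ^ 2) (by
    rw [← R.det_real hγ]
    congr 1
    unfold num den
    ring)
  refine h3.congr_of_eventuallyEq (Eventually.of_forall fun z => R.moebius_eq hγ z)

theorem div_num_mul_den (hn : 0 < n) (hγ : γ ∈ ξ.coeff.support) (hx : 0 < x) :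
    n / (R.num γ x * R.den γ x) = R.a γ / R.num γ x - R.c γ / R.den γ x := by
  have hU := (R.num_pos hn hγ hx).ne'
  have hV := (R.den_pos hn hγ hx).ne'
  rw [div_sub_div _ _ hU hV, ← R.det_real hγ]
  congr 1
  unfold num den
  ring

/-- The value at the row `(c, d)` of the function `c / (c x + d) · log (n (c x + d) / c)`, which
depends on the cusp `-d / c` only. Differences of its values at the two rows of `γ` account for the
discrepancy between the logarithmic terms and the derivative of the dilogarithm. -/
noncomputable def rowLog (n : ℕ) (x : ℝ) (c d : ℤ) : ℝ :=
  c / (c * x + d) * Real.log (n * ((c * x + d) / c))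

/-- The derivative of a dilogarithm term. -/
theorem hasDerivAt_rogersL_moebius (hn : 0 < n) (hγ : γ ∈ ξ.coeff.support) (hc : R.c γ ≠ 0)
    (hx : 0 < x) :
    HasDerivAt (fun z => rogersL (moebius γ z / imageInftyReal γ))
      (n * Real.log (R.num γ x * R.den γ x) / (2 * (R.num γ x * R.den γ x)) +
        (rowLog n x (R.c γ) (R.d γ) - rowLog n x (R.a γ) (R.b γ)) / 2) x := by
  have hU := R.num_pos hn hγ hx
  have hV := R.den_pos hn hγ hx
  have ha := R.a_pos hn hγ
  have hc' : (0 : ℝ) < R.c γ := by positivity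
  have hn' : (0 : ℝ) < n := by exact_mod_cast hn
  have hdet := R.det_real hγ
  have hdiv := R.div_num_mul_den hn hγ hx
  have ht := (R.hasDerivAt_moebius hn hγ hx).div_const (imageInftyReal γ)
  have htx : moebius γ x / imageInftyReal γ =
      R.c γ * R.num γ x / (R.a γ * R.den γ x) := by
    rw [R.moebius_eq hγ, R.imageInftyReal_eq hγ hc]
    field_simp
  have hone : 1 - moebius γ x / imageInftyReal γ = n / (R.a γ * R.den γ x) := by
    rw [htx, eq_div_iff (by positivity), sub_mul, div_mul_cancel₀ _ (by positivity), ← hdet]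
    unfold num den
    ring
  have h0 : 0 < moebius γ x / imageInftyReal γ := by rw [htx]; positivity
  have h1 : moebius γ x / imageInftyReal γ < 1 := by
    rw [← sub_pos, hone]; positivity
  refine ((hasDerivAt_rogersL h0 h1).comp x ht).congr_deriv ?_
  rw [hone, htx, R.imageInftyReal_eq hγ hc]
  have e1 : rowLog n x (R.c γ) (R.d γ) = R.c γ / R.den γ x *
      (Real.log n + Real.log (R.den γ x) - Real.log (R.c γ)) := by
    simp only [rowLog, Int.cast_natCast]
    rw [show (R.c γ : ℝ) * x + R.d γ = R.den γ x from rfl, Real.log_mul hn'.ne' (by positivity),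
      Real.log_div hV.ne' hc'.ne', add_sub_assoc]
  have e2 : rowLog n x (R.a γ) (R.b γ) = R.a γ / R.num γ x *
      (Real.log n + Real.log (R.num γ x) - Real.log (R.a γ)) := by
    simp only [rowLog, Int.cast_natCast]
    rw [show (R.a γ : ℝ) * x + R.b γ = R.num γ x from rfl, Real.log_mul hn'.ne' (by positivity),
      Real.log_div hU.ne' ha.ne', add_sub_assoc]
  have e3 : (n : ℝ) * Real.log (R.num γ x * R.den γ x) / (2 * (R.num γ x * R.den γ x)) =
      (R.a γ / R.num γ x - R.c γ / R.den γ x) *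
        (Real.log (R.num γ x) + Real.log (R.den γ x)) / 2 := by
    rw [← hdiv, Real.log_mul hU.ne' hV.ne']
    ring
  rw [e1, e2, e3, Real.log_div hn'.ne' (by positivity), Real.log_mul ha.ne' hV.ne',
    Real.log_div (by positivity) (by positivity), Real.log_mul hc'.ne' hU.ne',
    Real.log_mul ha.ne' hV.ne']
  have hnUV : (n : ℝ) = (R.a γ / R.num γ x - R.c γ / R.den γ x) * (R.num γ x * R.den γ x) := by
    rw [← hdiv]; field_simp
  have f1 : (n : ℝ) / R.den γ x ^ 2 / (R.a γ / R.c γ) / (R.c γ * R.num γ x / (R.a γ * R.den γ x)) =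
      R.a γ / R.num γ x - R.c γ / R.den γ x := by
    rw [← hdiv]; field_simp
  have f2 : (n : ℝ) / R.den γ x ^ 2 / (R.a γ / R.c γ) / (n / (R.a γ * R.den γ x)) =
      R.c γ / R.den γ x := by
    field_simp
  have hsplit : ∀ p q t s w : ℝ, -(p / t + q / s) / 2 * w = -(p * (w / t) + q * (w / s)) / 2 := by
    intro p q t s w
    ring
  rw [hsplit, f1, f2]
  ring

/-- The counterpart of `hasDerivAt_rogersL_moebius` for a matrix fixing `∞`. -/
theorem log_term_of_c_eq_zero (hn : 0 < n) (hγ : γ ∈ ξ.coeff.support) (hc : R.c γ = 0)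
    (hx : 0 < x) :
    n * Real.log (R.num γ x * R.den γ x) / (2 * (R.num γ x * R.den γ x)) +
      (rowLog n x (R.c γ) (R.d γ) - rowLog n x (R.a γ) (R.b γ)) / 2 = 0 := by
  have hU := R.num_pos hn hγ hx
  have ha := R.a_pos hn hγ
  have hd := R.d_pos hn hγ
  have hdet := R.det_real hγ
  have hV : R.den γ x = R.d γ := by simp [den, hc]
  simp only [hc, Nat.cast_zero, mul_zero, sub_zero] at hdet
  simp only [rowLog, hc, Int.cast_natCast, Nat.cast_zero, Int.cast_zero, zero_div, zero_mul]
  rw [show (R.a γ : ℝ) * x + R.b γ = R.num γ x from rfl, hV, ← hdet,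
    show (R.a γ : ℝ) * R.d γ * (R.num γ x / R.a γ) = R.num γ x * R.d γ by field_simp]
  field_simp
  ring

end NatReps

open NatReps

/-- The coefficients of the divergent terms `log ε` on both sides of the Hecke relation agree. -/
theorem ActsLikeHecke.sum_inv_num_mul_den (hn : 0 < n) (hξ : ActsLikeHecke n ξ) (R : NatReps n ξ)
    {x : ℝ} (hx : 0 < x) :
    ∑ γ ∈ ξ.coeff.support, (ξ.coeff γ : ℝ) * (n / (R.num γ x * R.den γ x)) =
      ArithmeticFunction.sigma 1 n / x := by
  have h := hξ.sum_rows R (fun c d => c / (c * x + d)) (fun c d => by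
    push_cast
    rw [neg_mul, ← neg_add, neg_div_neg_eq])
  have hl : ∀ γ ∈ ξ.coeff.support, (ξ.coeff γ : ℝ) * (n / (R.num γ x * R.den γ x)) =
      -((ξ.coeff γ : ℝ) * (((R.c γ : ℤ) : ℝ) / ((R.c γ : ℤ) * x + (R.d γ : ℤ)) -
        ((R.a γ : ℤ) : ℝ) / ((R.a γ : ℤ) * x + (R.b γ : ℤ)))) := by
    intro γ hγ
    rw [R.div_num_mul_den hn hγ hx]
    simp only [Int.cast_natCast, num, den]
    ring
  rw [Finset.sum_congr rfl hl, Finset.sum_neg_distrib, h, sigma_one_eq_sum, Finset.sum_div,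
    ← Finset.sum_neg_distrib]
  refine Finset.sum_congr rfl fun l hl => ?_
  have : (l : ℝ) ≠ 0 := by exact_mod_cast (Nat.pos_of_mem_divisors hl).ne'
  simp only [Int.cast_zero, zero_div, Int.cast_natCast, add_zero, zero_sub]
  field_simp

theorem ActsLikeHecke.sum_rowLog (hξ : ActsLikeHecke n ξ) (R : NatReps n ξ) {x : ℝ} :
    ∑ γ ∈ ξ.coeff.support, (ξ.coeff γ : ℝ) *
        (rowLog n x (R.c γ) (R.d γ) - rowLog n x (R.a γ) (R.b γ)) =
      -(ArithmeticFunction.sigma 1 n * Real.log (n * x) / x) := by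
  rw [hξ.sum_rows R (rowLog n x) (fun c d => by
    unfold rowLog
    push_cast
    rw [neg_mul, ← neg_add, neg_div_neg_eq, neg_div_neg_eq]), sigma_one_eq_sum, Finset.sum_mul,
    Finset.sum_div, ← Finset.sum_neg_distrib]
  refine Finset.sum_congr rfl fun l hl => ?_
  have : (l : ℝ) ≠ 0 := by exact_mod_cast (Nat.pos_of_mem_divisors hl).ne'
  simp only [rowLog, Int.cast_zero, zero_div, Int.cast_natCast, add_zero, zero_sub, zero_mul]
  rw [mul_div_cancel_left₀ x this]
  field_simp

theorem sum_div_eq_sigma (n : ℕ) :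
    ∑ l ∈ n.divisors, (n : ℝ) / l = ArithmeticFunction.sigma 1 n := by
  rw [sigma_one_eq_sum, ← Nat.sum_div_divisors n (fun l => (l : ℝ))]
  exact Finset.sum_congr rfl fun l hl => (Nat.cast_div_charZero (Nat.dvd_of_mem_divisors hl)).symm

theorem sum_div_mul_log (hn : 0 < n) :
    ∑ l ∈ n.divisors, (n : ℝ) / l * Real.log l =
      ArithmeticFunction.sigma 1 n * Real.log n - ∑ l ∈ n.divisors, (l : ℝ) * Real.log l := by
  have hn' : (n : ℝ) ≠ 0 := by exact_mod_cast hn.ne'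
  have h1 : ∀ l ∈ n.divisors, (n : ℝ) / l * Real.log l =
      ((n / l : ℕ) : ℝ) * (Real.log n - Real.log ((n / l : ℕ) : ℝ)) := by
    intro l hl
    have : (l : ℝ) ≠ 0 := by exact_mod_cast (Nat.pos_of_mem_divisors hl).ne'
    rw [Nat.cast_div_charZero (Nat.dvd_of_mem_divisors hl), Real.log_div hn' this]
    ring
  rw [Finset.sum_congr rfl h1,
    Nat.sum_div_divisors n (fun l => (l : ℝ) * (Real.log n - Real.log (l : ℝ))), sigma_one_eq_sum,
    Finset.sum_mul, ← Finset.sum_sub_distrib]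
  exact Finset.sum_congr rfl fun l _ => mul_sub _ _ _

theorem constA_eq (hn : 0 < n) :
    constA n = ∑ l ∈ n.divisors, (l : ℝ) * Real.log l -
      ArithmeticFunction.sigma 1 n * Real.log n / 2 := by
  have hn' : (n : ℝ) ≠ 0 := by exact_mod_cast hn.ne'
  rw [constA, sigma_one_eq_sum, Finset.mul_sum, Finset.sum_mul, Finset.sum_div,
    ← Finset.sum_sub_distrib]
  refine Finset.sum_congr rfl fun l hl => ?_
  have : (l : ℝ) ≠ 0 := by exact_mod_cast (Nat.pos_of_mem_divisors hl).ne'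
  rw [Real.log_div (pow_ne_zero 2 this) hn', Real.log_pow]
  push_cast
  ring

/-- The Hecke relation for the derivative of the modified Herglotz function: the finite part, as
`ε → 0`, of the integral of `t` times the generating function identity over `(ε, ∞)`. -/
theorem ActsLikeHecke.sum_modHerglotzDeriv (hn : 0 < n) (hξ : ActsLikeHecke n ξ)
    (R : NatReps n ξ) {x : ℝ} (hx : 0 < x) :
    ∑ γ ∈ ξ.coeff.support, (ξ.coeff γ : ℝ) *
        (n / R.den γ x ^ 2 * modHerglotzDeriv (moebius γ x) -
          n * Real.log (R.num γ x * R.den γ x) / (2 * (R.num γ x * R.den γ x))) =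
      ArithmeticFunction.sigma 1 n * (modHerglotzDeriv x - Real.log x / (2 * x)) -
        (∑ l ∈ n.divisors, (n : ℝ) / l * Real.log l) / x := by
  have hn' : (n : ℝ) ≠ 0 := by exact_mod_cast hn.ne'
  have hlpos : ∀ l ∈ n.divisors, (0 : ℝ) < l := fun l hl => by
    exact_mod_cast Nat.pos_of_mem_divisors hl
  have L := tendsto_finsetSum ξ.coeff.support fun γ hγ =>
    (tendsto_integral_mul_quadSum (R.num_pos hn hγ hx) (R.den_pos hn hγ hx)).const_mul
      (ξ.coeff γ : ℝ)
  have L' := tendsto_finsetSum n.divisors fun l hl =>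
    (tendsto_integral_mul_quadSum (mul_pos (hlpos l hl) hx) (hlpos l hl)).const_mul (l : ℝ)
  have hEq : ∀ ε ∈ Ioi (0 : ℝ), ∑ γ ∈ ξ.coeff.support, (ξ.coeff γ : ℝ) *
        ((∫ t in Ioi ε, t * quadSum (t * R.num γ x) (t * R.den γ x)) +
          2 * Real.log ε / (R.num γ x * R.den γ x)) =
      ∑ l ∈ n.divisors, (l : ℝ) * ((∫ t in Ioi ε, t * quadSum (t * (l * x)) (t * l)) +
          2 * Real.log ε / (l * x * l)) := by
    intro ε hε
    simp only [mul_add, Finset.sum_add_distrib]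
    congr 1
    · simp only [← integral_const_mul]
      rw [← integral_finsetSum _ fun γ hγ => (integrableOn_mul_quadSum (R.num_pos hn hγ hx)
          (R.den_pos hn hγ hx) hε).const_mul _,
        ← integral_finsetSum _ fun l hl => (integrableOn_mul_quadSum
          (mul_pos (hlpos l hl) hx) (hlpos l hl) hε).const_mul _]
      refine setIntegral_congr_fun measurableSet_Ioi fun t ht => ?_
      have ht0 : 0 < t := lt_trans hε ht
      have key := congrArg (t * ·) (hξ.sum_quadSum hn R (mul_pos ht0 hx) ht0)
      simp only [Finset.mul_sum] at key
      convert key using 2 with γ _ l _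
      · rw [mul_left_comm, num, den]
        congr 3 <;> ring
      · rw [mul_left_comm]
        congr 3 <;> ring
    · have h1 := hξ.sum_inv_num_mul_den hn R hx
      rw [← sum_div_eq_sigma, Finset.sum_div] at h1
      have h2 := congrArg (2 * Real.log ε / n * ·) h1
      simp only [Finset.mul_sum] at h2
      convert h2 using 2 with γ _ l hl
      · field_simp
      · have := (hlpos l hl).ne'
        field_simp
  have hlim := tendsto_nhds_unique (L.congr' (by
    filter_upwards [self_mem_nhdsWithin] with ε hε using hEq ε hε)) L'
  have h2 := congrArg ((n : ℝ) / 2 * ·) hlim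
  simp only [Finset.mul_sum] at h2
  convert h2 using 1
  · refine Finset.sum_congr rfl fun γ hγ => ?_
    have hU := (R.num_pos hn hγ hx).ne'
    have hV := (R.den_pos hn hγ hx).ne'
    rw [R.moebius_eq hγ]
    field_simp
  · rw [← sum_div_eq_sigma, Finset.sum_mul, Finset.sum_div, ← Finset.sum_sub_distrib]
    refine Finset.sum_congr rfl fun l hl => ?_
    have hl' := (hlpos l hl).ne'
    rw [mul_div_cancel_left₀ x hl', Real.log_mul (mul_ne_zero hl' hx.ne') hl',
      Real.log_mul hl' hx.ne']
    field_simp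
    ring

theorem rogersSum_eq (R : NatReps n ξ) (x : ℝ) :
    rogersSum ξ x = ∑ γ ∈ ξ.coeff.support,
      if R.c γ = 0 then 0 else (ξ.coeff γ : ℝ) * rogersL (moebius γ x / imageInftyReal γ) := by
  rw [rogersSum, Finset.sum_filter]
  refine Finset.sum_congr rfl fun γ hγ => ?_
  simp only [ne_eq, R.imageInfty_eq_infty_iff hγ, ite_not]

/-- The two sides of the theorem have the same derivative: the terms `n log (U V) / (2 U V)` from
the Hecke relation for `𝓕'` are absorbed by the dilogarithms, up to the explicit `sum_rowLog`. -/
theorem ActsLikeHecke.hasDerivAt (hn : 0 < n) (hξ : ActsLikeHecke n ξ) (R : NatReps n ξ) {x : ℝ}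
    (hx : 0 < x) :
    HasDerivAt (fun x => slashZero modHerglotz ξ x
      - (ArithmeticFunction.sigma 1 n : ℝ) * modHerglotz x - rogersSum ξ x
      - constA n * Real.log x) 0 x := by
  set q : MatPM → ℝ := fun γ =>
    n * Real.log (R.num γ x * R.den γ x) / (2 * (R.num γ x * R.den γ x)) with hq
  set e : MatPM → ℝ := fun γ =>
    rowLog n x (R.c γ) (R.d γ) - rowLog n x (R.a γ) (R.b γ) with he
  have d1 : HasDerivAt (slashZero modHerglotz ξ) (∑ γ ∈ ξ.coeff.support, (ξ.coeff γ : ℝ) *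
      (n / R.den γ x ^ 2 * modHerglotzDeriv (moebius γ x))) x := by
    refine HasDerivAt.fun_sum fun γ hγ => HasDerivAt.const_mul _ ?_
    have hpos : 0 < moebius γ x := by
      rw [R.moebius_eq hγ]
      exact div_pos (R.num_pos hn hγ hx) (R.den_pos hn hγ hx)
    rw [mul_comm]
    exact (hasDerivAt_modHerglotz hpos).comp x (R.hasDerivAt_moebius hn hγ hx)
  have d2 : HasDerivAt (rogersSum ξ)
      (∑ γ ∈ ξ.coeff.support, (ξ.coeff γ : ℝ) * (q γ + e γ / 2)) x := by
    rw [funext (rogersSum_eq R)]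
    refine HasDerivAt.fun_sum fun γ hγ => ?_
    by_cases hc : R.c γ = 0
    · simp only [hc, if_true]
      rw [hq, he]
      dsimp only
      rw [R.log_term_of_c_eq_zero hn hγ hc hx, mul_zero]
      exact hasDerivAt_const x 0
    · simp only [hc, if_false]
      exact (R.hasDerivAt_rogersL_moebius hn hγ hc hx).const_mul _
  have d3 := (hasDerivAt_modHerglotz hx).const_mul (ArithmeticFunction.sigma 1 n : ℝ)
  have d4 := (Real.hasDerivAt_log hx.ne').const_mul (constA n)
  refine (((d1.sub d3).sub d2).sub d4).congr_deriv ?_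
  have hn' : (n : ℝ) ≠ 0 := by exact_mod_cast hn.ne'
  have k1 := hξ.sum_modHerglotzDeriv hn R hx
  simp only [mul_sub (Rat.cast _ : ℝ), Finset.sum_sub_distrib] at k1
  rw [sum_div_mul_log hn] at k1
  have k2 : ∑ γ ∈ ξ.coeff.support, (ξ.coeff γ : ℝ) * e γ = _ := hξ.sum_rowLog R (x := x)
  have k3 : ∑ γ ∈ ξ.coeff.support, (ξ.coeff γ : ℝ) * (q γ + e γ / 2) =
      ∑ γ ∈ ξ.coeff.support, (ξ.coeff γ : ℝ) * q γ +
        (∑ γ ∈ ξ.coeff.support, (ξ.coeff γ : ℝ) * e γ) / 2 := by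
    rw [Finset.sum_div, ← Finset.sum_add_distrib]
    exact Finset.sum_congr rfl fun γ _ => by ring
  rw [k3, k2, constA_eq hn, Real.log_mul hn' hx.ne']
  linear_combination k1

end Representatives

end HerglotzHecke

theorem mainTheorem1 (n : ℕ) (hn : 1 ≤ n) (Tn : HerglotzHecke.MatRing)
    (hT : HerglotzHecke.ActsLikeHecke n Tn)
    (hpos : ∀ γ ∈ Tn.coeff.support, HerglotzHecke.IsNonneg γ) :
    ∃ C : ℝ, ∀ x : ℝ, 0 < x →
      HerglotzHecke.slashZero HerglotzHecke.modHerglotz Tn x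
          - (ArithmeticFunction.sigma 1 n : ℝ) * HerglotzHecke.modHerglotz x
          - HerglotzHecke.rogersSum Tn x
        = HerglotzHecke.constA n * Real.log x + C := by
  obtain ⟨R⟩ := hT.nonempty_natReps hpos
  have hder := fun (x : ℝ) (hx : x ∈ Set.Ioi (0 : ℝ)) => hT.hasDerivAt hn R hx
  obtain ⟨C, hC⟩ := isOpen_Ioi.exists_is_const_of_deriv_eq_zero isPreconnected_Ioi
    (fun x hx => (hder x hx).differentiableAt.differentiableWithinAt)
    (fun x hx => (hder x hx).deriv)
  exact ⟨C, fun x hx => by linarith [hC x hx]⟩
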